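/- Let $\mathcal A$ be a von Neumann algebra and let $E$ be an $\mathcal A$-$W^*$-correspondence: a complete self-dual right Hilbert $\mathcal A$-module with inner product $\langle\cdot,\cdot\rangle$ linear in the first variable, $\langle\xi b,\eta\rangle=\langle\xi,\eta\rangle b$, together with a normal $*$-homomorphism $\varphi:\mathcal A\to\mathcal L^a(E)$ into the adjointable operators, $a\cdot\xi=\varphi(a)\xi$. Let $\mathcal F^2(E)=\bigoplus_{n\ge 0}E^{\otimes n}$, $E^{\otimes 0}=\mathcal A$, be the Fock space (tensor products over $\mathcal A$ and direct sum in the sense of self-dual modules). For $a\in\mathcal A$ let $\varphi_\infty(a)=\mathrm{diag}(a,\varphi^{(1)}(a),\varphi^{(2)}(a),\dots)$, where $\varphi^{(n)}(a)(\xi_n\otimes\cdots\otimes\xi_1)=(\varphi(a)\xi_n)\otimes\xi_{n-1}\otimes\cdots\otimes\xi_1$, and for $\xi\in E$ let $T_\xi$ be the creation operator $\xi_n\otimes\cdots\otimes\xi_1\mapsto\xi\otimes\xi_n\otimes\cdots\otimes\xi_1$. The Toeplitz algebra $\mathcal F^\infty(E)$ is the weak-$*$ closed subalgebra of the $W^*$-algebra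 $\mathcal L^a(\mathcal F^2(E))$ generated by all $\varphi_\infty(a)$ and all $T_\xi$. Let $\mathbb D(E^*)=\{\zeta:\zeta^*\in E,\ \|\zeta^*\|<1\}$. For $(\zeta,a)\in\mathbb D(E^*)\times\mathcal A$ define the adjointable operator \[ W_{\zeta^*,a^*}:\mathcal A\to\mathcal F^2(E),\qquad W_{\zeta^*,a^*}b=\varphi_\infty(a^*)\bigoplus_{n\ge 0}(\zeta^*)^{\otimes n}b , \] where $(\zeta^*)^{\otimes 0}=1$, and for $R\in\mathcal F^\infty(E)$ let $\widehat R(\zeta,a)\in\mathcal A$ be the element by which the operator $W_{\zeta^*,a^*}^*\,R|_{\mathcal A}\in\mathcal L^a(\mathcal A)=\mathcal A$ multiplies from the left. Then for all $R,S\in\mathcal F^\infty(E)$ and all $(\zeta,a)\in\mathbb D(E^*)\times\mathcal A$, \[ \widehat{(RS)}(\zeta,a)=\widehat S\bigl(\zeta,\widehat R(\zeta,a)\bigr). \] Moreover, this evaluation is not multiplicative: if $\mathcal A\ne\{0\}$, there are $R,S\in\mathcal F^\infty(E)$ and $(\zeta,a)\in\mathbb D(E^*)\times\mathcal A$ with $\widehat{(RS)}(\zeta,a)\ne\widehat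 R(\zeta,a)\,\widehat S(\zeta,a)$. -/

import Mathlib

open scoped InnerProductSpace ENNReal

universe u v

theorem exists_negative_part {B : Type*} [NonUnitalCStarAlgebra B] (G : B)
    (hG : IsSelfAdjoint G) :
    ∃ N s : B, star s = s ∧ s * s = N ∧ star N * (G * N) = -(star (s * s * s) * (s * s * s)) ∧
      (s * s * s = 0 → ∃ r : B, star r * r = G) := by
  let _ : PartialOrder B := CStarAlgebra.spectralOrder B
  have _ : StarOrderedRing B := CStarAlgebra.spectralOrderedRing B
  have hN : 0 ≤ G⁻ := CFC.negPart_nonneg G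
  have hNs : star (G⁻) = G⁻ := IsSelfAdjoint.of_nonneg hN
  have hs : CFC.sqrt (G⁻) * CFC.sqrt (G⁻) = G⁻ := CFC.sqrt_mul_sqrt_self _ hN
  have hss : star (CFC.sqrt (G⁻)) = CFC.sqrt (G⁻) := IsSelfAdjoint.of_nonneg (CFC.sqrt_nonneg _)
  refine ⟨G⁻, CFC.sqrt (G⁻), hss, hs, ?_, fun hz => ?_⟩
  · have h1 : G * G⁻ = -(G⁻ * G⁻) := by
      have h2 := congrArg (· * G⁻) (CFC.posPart_sub_negPart G hG)
      simp only [sub_mul, CFC.posPart_mul_negPart, zero_sub] at h2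
      exact h2.symm
    rw [hNs, h1, star_mul, star_mul, hss]
    simp only [mul_neg, ← mul_assoc]
    rw [hs, mul_assoc (G⁻) (CFC.sqrt (G⁻)) (CFC.sqrt (G⁻)), hs, mul_assoc _ (CFC.sqrt (G⁻)) _, hs]
  · have h0 : G⁻ = 0 := by
      have h1 : star (G⁻) * G⁻ = 0 := by
        rw [hNs]
        conv_lhs => rw [← hs]
        rw [← mul_assoc, hz, zero_mul]
      exact (CStarRing.star_mul_self_eq_zero_iff _).mp h1
    have hGp : 0 ≤ G := (CFC.negPart_eq_zero_iff G hG).mp h0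
    refine ⟨CFC.sqrt G, ?_⟩
    rw [show star (CFC.sqrt G) = CFC.sqrt G from IsSelfAdjoint.of_nonneg (CFC.sqrt_nonneg _),
      CFC.sqrt_mul_sqrt_self _ hGp]

/-- A right Hilbert module over `A`: a complex normed space `E` with a right `A`-action (a module over
the opposite algebra) and an `A`-valued inner product `ip x y = ⟨x, y⟩`, linear in the first variable,
with `⟨x · b, y⟩ = ⟨x, y⟩ b`, `⟨x, y⟩* = ⟨y, x⟩`, `⟨x, x⟩ ≥ 0`, definite, and whose norm is
`‖x‖ = ‖⟨x, x⟩‖ ^ (1/2)`. Completeness is required separately where it is needed. -/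
class HilbertModule (A : Type v) (E : Type u) [CStarAlgebra A] [PartialOrder A]
    [NormedAddCommGroup E] [NormedSpace ℂ E] [Module Aᵐᵒᵖ E] where
  ip : E → E → A
  ip_add_left : ∀ x y z : E, ip (x + y) z = ip x z + ip y z
  ip_smul_left : ∀ (c : ℂ) (x y : E), ip (c • x) y = c • ip x y
  ip_act_left : ∀ (b : A) (x y : E), ip (MulOpposite.op b • x) y = ip x y * b
  star_ip : ∀ x y : E, star (ip x y) = ip y x
  ip_self_nonneg : ∀ x : E, 0 ≤ ip x x
  eq_zero_of_ip_self : ∀ x : E, ip x x = 0 → x = 0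
  norm_sq_eq : ∀ x : E, ‖x‖ ^ 2 = ‖ip x x‖

namespace HilbertModule

section basic
variable {A : Type v} {E : Type u} [CStarAlgebra A] [PartialOrder A]
  [NormedAddCommGroup E] [NormedSpace ℂ E] [Module Aᵐᵒᵖ E] [HilbertModule A E]

theorem ip_add_right (x y z : E) : ip (A := A) x (y + z) = ip x y + ip x z := by
  rw [← star_ip, ip_add_left, star_add, star_ip, star_ip]

theorem ip_smul_right (c : ℂ) (x y : E) : ip (A := A) x (c • y) = star c • ip x y := by
  rw [← star_ip, ip_smul_left, star_smul, star_ip]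

theorem ip_act_right (b : A) (x y : E) :
    ip (A := A) x (MulOpposite.op b • y) = star b * ip x y := by
  rw [← star_ip, ip_act_left, star_mul, star_ip]

theorem ip_zero_left (y : E) : ip (A := A) 0 y = 0 := by
  have := ip_smul_left (A := A) 0 (0 : E) y
  simpa using this

theorem ip_zero_right (y : E) : ip (A := A) y 0 = 0 := by
  rw [← star_ip, ip_zero_left, star_zero]

theorem ip_sum_left {ι : Type*} (s : Finset ι) (f : ι → E) (y : E) :
    ip (A := A) (∑ i ∈ s, f i) y = ∑ i ∈ s, ip (f i) y := by
  classical
  induction s using Finset.induction_on with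
  | empty => simp [ip_zero_left]
  | insert i s hi ih => rw [Finset.sum_insert hi, Finset.sum_insert hi, ip_add_left, ih]

theorem ip_sum_right {ι : Type*} (s : Finset ι) (f : ι → E) (y : E) :
    ip (A := A) y (∑ i ∈ s, f i) = ∑ i ∈ s, ip y (f i) := by
  rw [← star_ip, ip_sum_left, star_sum]; simp_rw [star_ip]

variable [StarOrderedRing A]

/-- The Gram matrix of a finite family factors as `B* B`. -/
theorem exists_gram_factor {ι : Type*} [Fintype ι] (x : ι → E) :
    ∃ B : ι → ι → A, ∀ i j, ip (x j) (x i) = ∑ l, star (B l i) * B l j := by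
  classical
  let G : CStarMatrix ι ι A := CStarMatrix.ofMatrix fun i j => ip (x j) (x i)
  have hGa : ∀ i j, G i j = ip (x j) (x i) := fun _ _ => rfl
  have hG : IsSelfAdjoint G := by
    ext i j
    rw [CStarMatrix.star_apply, hGa, hGa, star_ip]
  have hdiag : ∀ M : CStarMatrix ι ι A, ∀ i, 0 ≤ (star M * (G * M)) i i := by
    intro M i
    have : (star M * (G * M)) i i =
        ip (∑ j, MulOpposite.op (M j i) • x j) (∑ j, MulOpposite.op (M j i) • x j) := by
      simp only [ip_sum_left, ip_sum_right, ip_act_left, ip_act_right, CStarMatrix.mul_apply,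
        CStarMatrix.star_apply, hGa, Finset.mul_sum]
    rw [this]
    exact ip_self_nonneg _
  obtain ⟨N, s, hss, hNs, hcube, hfin⟩ := exists_negative_part G hG
  have hz : s * s * s = 0 := by
    ext k i
    have h1 := hdiag N i
    rw [hcube, CStarMatrix.neg_apply, CStarMatrix.mul_apply] at h1
    have h2 : ∀ l ∈ Finset.univ, 0 ≤ star (s * s * s) i l * (s * s * s) l i := by
      intro l _
      rw [CStarMatrix.star_apply]
      exact star_mul_self_nonneg _
    have h3 := le_antisymm (neg_nonneg.mp h1) (Finset.sum_nonneg h2)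
    have h4 := (Finset.sum_eq_zero_iff_of_nonneg h2).mp h3 k (Finset.mem_univ _)
    rw [CStarMatrix.star_apply] at h4
    simpa using (CStarRing.star_mul_self_eq_zero_iff _).mp h4
  obtain ⟨r, hr⟩ := hfin hz
  refine ⟨fun i j => r i j, fun i j => ?_⟩
  rw [← hGa, ← hr]
  simp only [CStarMatrix.mul_apply, CStarMatrix.star_apply]
/-- The algebra `A` as a right Hilbert module over itself, with `⟨b, c⟩ = c* b`. -/
noncomputable instance selfModule : HilbertModule A A where
  ip b c := star c * b
  ip_add_left x y z := mul_add _ _ _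
  ip_smul_left c x y := mul_smul_comm _ _ _
  ip_act_left b x y := (mul_assoc (star y) x b).symm
  star_ip x y := by rw [star_mul, star_star]
  ip_self_nonneg x := star_mul_self_nonneg x
  eq_zero_of_ip_self x hx := (CStarRing.star_mul_self_eq_zero_iff x).mp hx
  norm_sq_eq x := by rw [CStarRing.norm_star_mul_self, sq]

end basic

end HilbertModule

/-- A Hilbert space carrying a (possibly degenerate) `*`-representation of `A`. -/
structure HilbertRep (A : Type v) [CStarAlgebra A] where
  space : Type u
  [normed : NormedAddCommGroup space]
  [innerProduct : InnerProductSpace ℂ space]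
  [complete : CompleteSpace space]
  rep : A →⋆ₙₐ[ℂ] (space →L[ℂ] space)

attribute [instance] HilbertRep.normed HilbertRep.innerProduct HilbertRep.complete

section Tensor

variable {A : Type v} [CStarAlgebra A] [PartialOrder A] [StarOrderedRing A]
variable (E : Type u) [NormedAddCommGroup E] [NormedSpace ℂ E] [Module Aᵐᵒᵖ E] [HilbertModule A E]
variable (K : HilbertRep.{u} A)

open HilbertModule

/-- The free complex vector space on `E × K`, before separation and completion. -/
def PreTensor : Type u := (E × K.space) →₀ ℂ

noncomputable instance : AddCommGroup (PreTensor E K) :=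
  inferInstanceAs (AddCommGroup ((E × K.space) →₀ ℂ))
noncomputable instance : Module ℂ (PreTensor E K) :=
  inferInstanceAs (Module ℂ ((E × K.space) →₀ ℂ))

variable {E K}

/-- The sesquilinear form with `(x ⊗ k, y ⊗ l) ↦ ⟪k, ⟨y, x⟩ · l⟫`. -/
noncomputable def preInner (f g : (E × K.space) →₀ ℂ) : ℂ :=
  f.sum fun p c => g.sum fun q d => star c * d * ⟪p.2, K.rep (ip q.1 p.1) q.2⟫_ℂ

theorem gram_rep {ι : Type*} [Fintype ι] (x : ι → E) : ∃ B : ι → ι → A, ∀ k k' : ι → K.space,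
    ∑ i, ∑ j, ⟪k i, K.rep (ip (x j) (x i)) (k' j)⟫_ℂ =
      ∑ l, ⟪∑ i, K.rep (B l i) (k i), ∑ i, K.rep (B l i) (k' i)⟫_ℂ := by
  obtain ⟨B, hB⟩ := exists_gram_factor (A := A) x
  refine ⟨B, fun k k' => ?_⟩
  simp only [hB, map_sum, sum_inner, inner_sum, map_mul, sum_apply]
  rw [Finset.sum_comm' (t' := Finset.univ) (s' := fun _ => Finset.univ) (by simp)]
  have h : ∀ l i j, ⟪k i, (K.rep (star (B l i)) * K.rep (B l j)) (k' j)⟫_ℂ =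
      ⟪K.rep (B l i) (k i), K.rep (B l j) (k' j)⟫_ℂ := by
    intro l i j
    rw [map_star, ContinuousLinearMap.star_eq_adjoint, mul_apply_eq_comp,
      ContinuousLinearMap.adjoint_inner_right]
  simp only [h]
  calc _ = ∑ y, ∑ l, ∑ i, ⟪K.rep (B l i) (k i), K.rep (B l y) (k' y)⟫_ℂ := by
        refine Finset.sum_congr rfl fun y _ => Finset.sum_comm
    _ = ∑ l, ∑ y, ∑ i, ⟪K.rep (B l i) (k i), K.rep (B l y) (k' y)⟫_ℂ := Finset.sum_comm

theorem preInner_eq (f g : (E × K.space) →₀ ℂ) (s : Finset (E × K.space))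
    (hf : f.support ⊆ s) (hg : g.support ⊆ s) :
    preInner f g = ∑ p : s, ∑ q : s,
      ⟪f p • p.1.2, K.rep (ip q.1.1 p.1.1) (g q • q.1.2)⟫_ℂ := by
  have h1 : preInner f g = ∑ p ∈ s, ∑ q ∈ s,
      ⟪f p • p.2, K.rep (ip q.1 p.1) (g q • q.2)⟫_ℂ := by
    unfold preInner
    rw [Finsupp.sum_of_support_subset f hf _ (by simp)]
    refine Finset.sum_congr rfl fun p _ => ?_
    rw [Finsupp.sum_of_support_subset g hg _ (by simp)]
    refine Finset.sum_congr rfl fun q _ => ?_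
    rw [map_smul, inner_smul_left, inner_smul_right]
    simp [mul_assoc]
  rw [h1, ← Finset.sum_coe_sort]
  refine Finset.sum_congr rfl fun p _ => ?_
  rw [← Finset.sum_coe_sort]

theorem preInner_self_nonneg (f : (E × K.space) →₀ ℂ) : 0 ≤ RCLike.re (preInner f f) := by
  rw [preInner_eq f f f.support subset_rfl subset_rfl]
  obtain ⟨B, hB⟩ := gram_rep (K := K) (fun p : f.support => p.1.1)
  rw [hB (fun p => f p • p.1.2) (fun p => f p • p.1.2), map_sum]
  exact Finset.sum_nonneg fun l _ => inner_self_nonneg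

theorem preInner_symm (f g : (E × K.space) →₀ ℂ) :
    (starRingEnd ℂ) (preInner g f) = preInner f g := by
  classical
  rw [preInner_eq g f (f.support ∪ g.support) Finset.subset_union_right Finset.subset_union_left,
    preInner_eq f g (f.support ∪ g.support) Finset.subset_union_left Finset.subset_union_right,
    map_sum]
  simp only [map_sum]
  rw [Finset.sum_comm]
  refine Finset.sum_congr rfl fun p _ => Finset.sum_congr rfl fun q _ => ?_
  rw [inner_conj_symm, ← ContinuousLinearMap.adjoint_inner_right,
    ← ContinuousLinearMap.star_eq_adjoint, ← map_star, star_ip]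

theorem preInner_add_left (f g h : (E × K.space) →₀ ℂ) :
    preInner (f + g) h = preInner f h + preInner g h := by
  unfold preInner
  rw [Finsupp.sum_add_index']
  · intro p; simp
  · intro p c d
    rw [← Finsupp.sum_add]
    simp [add_mul]

theorem preInner_smul_left (c : ℂ) (f g : (E × K.space) →₀ ℂ) :
    preInner (c • f) g = (starRingEnd ℂ) c * preInner f g := by
  unfold preInner
  rw [Finsupp.sum_smul_index' (by simp), Finsupp.mul_sum]
  refine Finsupp.sum_congr fun p _ => ?_
  rw [Finsupp.mul_sum]
  refine Finsupp.sum_congr fun q _ => ?_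
  simp [mul_assoc]

theorem preInner_single (p q : E × K.space) :
    preInner (Finsupp.single p 1) (Finsupp.single q 1) = ⟪p.2, K.rep (ip q.1 p.1) q.2⟫_ℂ := by
  unfold preInner
  rw [Finsupp.sum_single_index (by simp), Finsupp.sum_single_index (by simp)]
  simp

variable (E K)

/-- The form `preInner` as a positive semidefinite inner product. -/
@[reducible] noncomputable def preTensorCore : PreInnerProductSpace.Core ℂ (PreTensor E K) where
  inner := preInner (E := E) (K := K)
  conj_inner_symm f g := preInner_symm f g
  re_inner_nonneg := preInner_self_nonneg
  add_left := preInner_add_left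
  smul_left f g c := preInner_smul_left c f g

noncomputable instance : SeminormedAddCommGroup (PreTensor E K) :=
  @InnerProductSpace.Core.toSeminormedAddCommGroup ℂ (PreTensor E K) _ _ _ (preTensorCore E K)

noncomputable instance : InnerProductSpace ℂ (PreTensor E K) :=
  InnerProductSpace.ofCore (preTensorCore E K)

/-- The interior tensor product `E ⊗ K` of a Hilbert module with a Hilbert space carrying a
representation of `A`: the (separated) completion for the form `preInner`. The balancing relation
`(x · b) ⊗ k = x ⊗ (b · k)` holds because the difference has norm zero. -/
abbrev TensorSpace : Type u := UniformSpace.Completion (PreTensor E K)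

variable {E K}

/-- The canonical map from finite formal combinations to the tensor product. -/
noncomputable def ofPre : ((E × K.space) →₀ ℂ) →ₗ[ℂ] TensorSpace E K :=
  (UniformSpace.Completion.toComplL (𝕜 := ℂ) (E := PreTensor E K)).toLinearMap

theorem denseRange_ofPre : DenseRange (ofPre (E := E) (K := K)) :=
  UniformSpace.Completion.denseRange_coe (α := PreTensor E K)

theorem inner_ofPre (f g : (E × K.space) →₀ ℂ) :
    ⟪ofPre f, ofPre g⟫_ℂ = preInner f g :=
  UniformSpace.Completion.inner_coe (𝕜 := ℂ) (E := PreTensor E K) f g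

/-- The elementary tensor `x ⊗ k`. -/
noncomputable def tmul (x : E) (k : K.space) : TensorSpace E K := ofPre (Finsupp.single (x, k) 1)

theorem inner_tmul (x y : E) (k k' : K.space) :
    ⟪tmul x k, tmul y k'⟫_ℂ = ⟪k, K.rep (ip y x) k'⟫_ℂ := by
  rw [tmul, tmul, inner_ofPre, preInner_single]

theorem ofPre_eq (f : (E × K.space) →₀ ℂ) : ofPre f = f.sum fun p c => c • tmul p.1 p.2 := by
  conv_lhs => rw [← f.sum_single, map_finsuppSum]
  refine Finsupp.sum_congr fun p _ => ?_
  rw [tmul, ← map_smul, Finsupp.smul_single, smul_eq_mul, mul_one]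

theorem ext_tmul {L : Type*} [NormedAddCommGroup L] [NormedSpace ℂ L]
    {S T : TensorSpace E K →L[ℂ] L} (h : ∀ x k, S (tmul x k) = T (tmul x k)) : S = T := by
  refine ContinuousLinearMap.ext fun z => ?_
  refine (denseRange_ofPre (E := E) (K := K)).induction ?_
    (isClosed_eq S.continuous T.continuous) z
  rintro _ ⟨f, rfl⟩
  rw [ofPre_eq, map_finsuppSum, map_finsuppSum]
  refine Finsupp.sum_congr fun p _ => ?_
  rw [map_smul, map_smul, h]

theorem ext_inner_tmul {z w : TensorSpace E K} (h : ∀ x k, ⟪tmul x k, z⟫_ℂ = ⟪tmul x k, w⟫_ℂ) :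
    z = w := by
  have : innerSL ℂ z = innerSL ℂ w := by
    refine ext_tmul fun x k => ?_
    rw [innerSL_apply_apply, innerSL_apply_apply, ← inner_conj_symm, h, inner_conj_symm]
  refine ext_inner_right ℂ fun v => ?_
  simpa using congrArg (fun T => T v) this

/-- The creation map `k ↦ x ⊗ k`. -/
noncomputable def creation (x : E) : K.space →L[ℂ] TensorSpace E K :=
  LinearMap.mkContinuous
    { toFun := fun k => tmul x k
      map_add' := fun k k' => ext_inner_tmul fun y l => by
        rw [inner_add_right, inner_tmul, inner_tmul, inner_tmul, map_add, inner_add_right]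
      map_smul' := fun c k => ext_inner_tmul fun y l => by
        rw [RingHom.id_apply, inner_smul_right, inner_tmul, inner_tmul, map_smul,
          inner_smul_right] }
    ‖x‖ (fun k => by
      have h1 : ‖K.rep (ip x x) k‖ ≤ ‖x‖ ^ 2 * ‖k‖ := by
        refine (ContinuousLinearMap.le_opNorm _ _).trans ?_
        gcongr
        rw [HilbertModule.norm_sq_eq (A := A)]
        exact NonUnitalStarAlgHom.norm_apply_le _ _
      have h2 : ‖tmul x k‖ ^ 2 ≤ (‖x‖ * ‖k‖) ^ 2 := by
        rw [← inner_self_eq_norm_sq (𝕜 := ℂ), inner_tmul]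
        calc _ ≤ ‖⟪k, K.rep (ip x x) k⟫_ℂ‖ := RCLike.re_le_norm _
          _ ≤ ‖k‖ * ‖K.rep (ip x x) k‖ := norm_inner_le_norm _ _
          _ ≤ ‖k‖ * (‖x‖ ^ 2 * ‖k‖) := by gcongr
          _ = _ := by ring
      exact (sq_le_sq₀ (norm_nonneg _) (by positivity)).mp h2)

@[simp] theorem creation_apply (x : E) (k : K.space) : creation x k = tmul x k := rfl

theorem norm_creation_le (x : E) : ‖creation (K := K) x‖ ≤ ‖x‖ :=
  LinearMap.mkContinuous_norm_le _ (norm_nonneg _) _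

/-- The operator `I ⊗ b` with `x ⊗ k ↦ x ⊗ b k`, for `b` commuting with the representation. -/
noncomputable def idTensor (b : K.space →L[ℂ] K.space) : TensorSpace E K →L[ℂ] TensorSpace E K :=
  (Finsupp.lift (TensorSpace E K) ℂ (E × K.space)
    fun p => tmul p.1 (b p.2)).extendOfNorm ofPre

theorem bound_of_sq {x y C : ℝ} (hy : 0 ≤ y) (hC : 0 ≤ C) (h : x ^ 2 ≤ C ^ 2 * y ^ 2) :
    x ≤ C * y := by
  rw [← mul_pow] at h
  exact (abs_le_of_sq_le_sq' h (by positivity)).2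

theorem norm_sum_tmul {ι : Type*} [Fintype ι] (c : ι → ℂ) (x : ι → E) (k : ι → K.space) :
    ‖∑ i, c i • tmul (x i) (k i)‖ ^ 2 =
      RCLike.re (∑ i, ∑ j, ⟪c i • k i, K.rep (ip (x j) (x i)) (c j • k j)⟫_ℂ) := by
  rw [← inner_self_eq_norm_sq (𝕜 := ℂ), sum_inner]
  simp only [inner_sum, inner_smul_left, inner_smul_right, inner_tmul, map_smul]

theorem idTensor_bound (b : K.space →L[ℂ] K.space)
    (hb : ∀ a, b * K.rep a = K.rep a * b) (f : (E × K.space) →₀ ℂ) :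
    ‖(Finsupp.lift (TensorSpace E K) ℂ (E × K.space) fun p => tmul p.1 (b p.2)) f‖ ≤
      ‖b‖ * ‖ofPre f‖ := by
  refine bound_of_sq (norm_nonneg _) (norm_nonneg _) ?_
  rw [ofPre_eq, Finsupp.lift_apply, Finsupp.sum, Finsupp.sum, ← Finset.sum_coe_sort,
    ← Finset.sum_coe_sort f.support (fun p => f p • tmul p.1 p.2),
    norm_sum_tmul, norm_sum_tmul]
  obtain ⟨B, hB⟩ := gram_rep (K := K) (fun p : f.support => p.1.1)
  rw [hB (fun p => f p • b p.1.2) (fun p => f p • b p.1.2),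
    hB (fun p => f p • p.1.2) (fun p => f p • p.1.2), map_sum, map_sum, Finset.mul_sum]
  refine Finset.sum_le_sum fun l _ => ?_
  have h : ∑ i : f.support, K.rep (B l i) (f i • b i.1.2) =
      b (∑ i : f.support, K.rep (B l i) (f i • i.1.2)) := by
    rw [map_sum]
    refine Finset.sum_congr rfl fun i _ => ?_
    have := congrArg (fun T => T (f i • i.1.2)) (hb (B l i))
    simp only [mul_apply_eq_comp] at this
    rw [this, map_smul b]
  rw [h, inner_self_eq_norm_sq, inner_self_eq_norm_sq, ← mul_pow]
  gcongr
  exact b.le_opNorm _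

theorem idTensor_tmul (b : K.space →L[ℂ] K.space)
    (hb : ∀ a, b * K.rep a = K.rep a * b) (x : E) (k : K.space) :
    idTensor b (tmul x k) = tmul x (b k) := by
  have := LinearMap.extendOfNorm_eq (denseRange_ofPre (E := E) (K := K))
    ⟨‖b‖, idTensor_bound b hb⟩ (Finsupp.single (x, k) 1)
  rw [idTensor, tmul, this]
  simp

theorem norm_idTensor_le (b : K.space →L[ℂ] K.space)
    (hb : ∀ a, b * K.rep a = K.rep a * b) : ‖idTensor (E := E) b‖ ≤ ‖b‖ :=
  LinearMap.opNorm_extendOfNorm_le (denseRange_ofPre (E := E) (K := K)) (norm_nonneg _)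
    (idTensor_bound b hb)

theorem star_idTensor (b : K.space →L[ℂ] K.space) (hb : ∀ a, b * K.rep a = K.rep a * b)
    (hb' : ∀ a, star b * K.rep a = K.rep a * star b) :
    star (idTensor (E := E) b) = idTensor (star b) := by
  refine ext_tmul fun x k => ext_inner_tmul fun y l => ?_
  rw [ContinuousLinearMap.star_eq_adjoint, ContinuousLinearMap.adjoint_inner_right,
    idTensor_tmul b hb, idTensor_tmul _ hb', inner_tmul, inner_tmul, ← mul_apply_eq_comp, ← hb',
    mul_apply_eq_comp, ContinuousLinearMap.star_eq_adjoint,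
    ContinuousLinearMap.adjoint_inner_right]

end Tensor

/-- An `A`-correspondence structure on the Hilbert module `E`: a left action of `A` by bounded
adjointable operators, that is, a `*`-homomorphism `left` from `A` into the adjointable operators.
Unitality of the left action is not required. -/
structure Correspondence (A : Type v) (E : Type u) [CStarAlgebra A] [PartialOrder A]
    [NormedAddCommGroup E] [NormedSpace ℂ E] [Module Aᵐᵒᵖ E] [HilbertModule A E] where
  left : A →ₙₐ[ℂ] (E →L[ℂ] E)
  ip_left : ∀ (a : A) (x y : E),
    HilbertModule.ip (A := A) (left a x) y = HilbertModule.ip x (left (star a) y)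

section LeftTensor

open HilbertModule

variable {A : Type v} [CStarAlgebra A] [PartialOrder A] [StarOrderedRing A]
variable {E : Type u} [NormedAddCommGroup E] [NormedSpace ℂ E] [Module Aᵐᵒᵖ E] [HilbertModule A E]
variable {K : HilbertRep.{u} A} (C : Correspondence A E)

/-- The operator `φ(a) ⊗ I` with `x ⊗ k ↦ (a · x) ⊗ k`. -/
noncomputable def leftTensor (a : A) : TensorSpace E K →L[ℂ] TensorSpace E K :=
  (Finsupp.lift (TensorSpace E K) ℂ (E × K.space)
    fun p => tmul (C.left a p.1) p.2).extendOfNorm ofPre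

theorem re_gram_nonneg {ι : Type*} [Fintype ι] (x : ι → E) (k : ι → K.space) :
    0 ≤ RCLike.re (∑ i, ∑ j, ⟪k i, K.rep (ip (x j) (x i)) (k j)⟫_ℂ) := by
  obtain ⟨B, hB⟩ := gram_rep (K := K) x
  rw [hB k k, map_sum]
  exact Finset.sum_nonneg fun l _ => inner_self_nonneg

theorem ip_sub_left (x y z : E) : ip (A := A) (x - y) z = ip x z - ip y z := by
  have := ip_add_left (A := A) (x - y) y z
  rw [sub_add_cancel] at this
  rw [this, add_sub_cancel_right]

theorem ip_sub_right (x y z : E) : ip (A := A) x (y - z) = ip x y - ip x z := by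
  rw [← star_ip, ip_sub_left, star_sub, star_ip, star_ip]

theorem leftTensor_bound (a : A) (f : (E × K.space) →₀ ℂ) :
    ‖(Finsupp.lift (TensorSpace E K) ℂ (E × K.space) fun p => tmul (C.left a p.1) p.2) f‖ ≤
      ‖a‖ * ‖ofPre f‖ := by
  refine bound_of_sq (norm_nonneg _) (norm_nonneg _) ?_
  rw [ofPre_eq, Finsupp.lift_apply, Finsupp.sum, Finsupp.sum, ← Finset.sum_coe_sort,
    ← Finset.sum_coe_sort f.support (fun p => f p • tmul p.1 p.2),
    norm_sum_tmul, norm_sum_tmul]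
  obtain ⟨r, hr⟩ := CStarAlgebra.nonneg_iff_eq_star_mul_self.mp
    (sub_nonneg.mpr (CStarAlgebra.star_mul_le_algebraMap_norm_sq (a := a)))
  have hip : ∀ x y : E, ip (A := A) (C.left a x) (C.left a y) =
      ((‖a‖ ^ 2 : ℝ) : ℂ) • (ip x y - ip (x - C.left 1 x) (y - C.left 1 y)) -
        ip (C.left r x) (C.left r y) := by
    intro x y
    have h1 : C.left (star a * a) =
        ((‖a‖ ^ 2 : ℝ) : ℂ) • C.left 1 - C.left (star r * r) := by
      rw [← map_smul, ← map_sub, ← hr, Complex.coe_smul, ← Algebra.algebraMap_eq_smul_one,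
        sub_sub_cancel]
    have h2 : ∀ c : A, ip (A := A) (C.left c x) (C.left c y) = ip x (C.left (star c * c) y) := by
      intro c
      rw [C.ip_left, map_mul]; rfl
    have h3 : ip (A := A) (C.left 1 x) (C.left 1 y) = ip x (C.left 1 y) := by
      rw [h2]; simp
    have h4 : ip (A := A) (C.left 1 x) y = ip x (C.left 1 y) := by
      rw [C.ip_left, star_one]
    rw [h2, h2, h1]
    simp only [ip_sub_left, ip_sub_right, h3, h4, sub_apply,
      smul_apply, ip_smul_right]
    simp
  have key : ∀ i j : f.support, ⟪f i • i.1.2, K.rep (ip (C.left a j.1.1) (C.left a i.1.1))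
      (f j • j.1.2)⟫_ℂ = ((‖a‖ ^ 2 : ℝ) : ℂ) * ⟪f i • i.1.2, K.rep (ip j.1.1 i.1.1) (f j • j.1.2)⟫_ℂ
        - ((‖a‖ ^ 2 : ℝ) : ℂ) * ⟪f i • i.1.2, K.rep (ip (j.1.1 - C.left 1 j.1.1)
          (i.1.1 - C.left 1 i.1.1)) (f j • j.1.2)⟫_ℂ
        - ⟪f i • i.1.2, K.rep (ip (C.left r j.1.1) (C.left r i.1.1)) (f j • j.1.2)⟫_ℂ := by
    intro i j
    rw [hip, map_sub K.rep, map_smul K.rep, map_sub K.rep, sub_apply, inner_sub_right,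
      smul_apply, inner_smul_right, sub_apply, inner_sub_right, mul_sub]
  simp only [key, Finset.sum_sub_distrib, ← Finset.mul_sum, map_sub]
  have h1 := re_gram_nonneg (K := K) (fun i : f.support => i.1.1 - C.left 1 i.1.1)
    (fun i => f i • i.1.2)
  have h2 := re_gram_nonneg (K := K) (fun i : f.support => C.left r i.1.1)
    (fun i => f i • i.1.2)
  have h3 : ∀ z : ℂ, RCLike.re (((‖a‖ ^ 2 : ℝ) : ℂ) * z) = ‖a‖ ^ 2 * RCLike.re z := fun z => by
    simp only [RCLike.re_eq_complex_re, Complex.re_ofReal_mul]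
  rw [h3, h3]
  nlinarith [mul_nonneg (sq_nonneg ‖a‖) h1]

theorem leftTensor_tmul (a : A) (x : E) (k : K.space) :
    leftTensor C a (tmul x k) = tmul (C.left a x) k := by
  have := LinearMap.extendOfNorm_eq (denseRange_ofPre (E := E) (K := K))
    ⟨‖a‖, leftTensor_bound C a⟩ (Finsupp.single (x, k) 1)
  rw [leftTensor, tmul, this]
  simp

theorem norm_leftTensor_le (a : A) : ‖leftTensor (K := K) C a‖ ≤ ‖a‖ :=
  LinearMap.opNorm_extendOfNorm_le (denseRange_ofPre (E := E) (K := K)) (norm_nonneg _)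
    (leftTensor_bound C a)

theorem inner_leftTensor (a : A) (x y : E) (k l : K.space) :
    ⟪tmul y l, leftTensor C a (tmul x k)⟫_ℂ = ⟪l, K.rep (ip (C.left a x) y) k⟫_ℂ := by
  rw [leftTensor_tmul, inner_tmul]

/-- The Hilbert space `E ⊗ K` with the representation `a ↦ φ(a) ⊗ I` of `A`. -/
noncomputable def tensorRep (K : HilbertRep.{u} A) : HilbertRep.{u} A where
  space := TensorSpace E K
  rep :=
    { toFun := leftTensor C
      map_smul' := fun c a => ext_tmul fun x k => ext_inner_tmul fun y l => by
        simp only [inner_leftTensor, smul_apply, inner_smul_right, map_smul,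
          ip_smul_left, MonoidHom.id_apply]
      map_zero' := ext_tmul fun x k => ext_inner_tmul fun y l => by
        simp only [inner_leftTensor, zero_apply, inner_zero_right, map_zero,
          ip_zero_left]
      map_add' := fun a b => ext_tmul fun x k => ext_inner_tmul fun y l => by
        simp only [inner_leftTensor, add_apply, inner_add_right, map_add,
          ip_add_left]
      map_mul' := fun a b => ext_tmul fun x k => by
        rw [mul_apply_eq_comp, leftTensor_tmul, leftTensor_tmul, leftTensor_tmul,
          map_mul, mul_apply_eq_comp]
      map_star' := fun a => ext_tmul fun x k => ext_inner_tmul fun y l => by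
        rw [inner_leftTensor, ContinuousLinearMap.star_eq_adjoint,
          ContinuousLinearMap.adjoint_inner_right, leftTensor_tmul, inner_tmul, C.ip_left,
          star_star] }

end LeftTensor

section DirectSum

theorem memℓp_of_bound {G G' : ℕ → Type*} [∀ n, NormedAddCommGroup (G n)]
    [∀ n, NormedAddCommGroup (G' n)] {M : ℝ} (hM : 0 ≤ M)
    (f : lp G 2) (g : ∀ n, G' n) (h : ∀ n, ‖g n‖ ≤ M * ‖f n‖) : Memℓp g 2 := by
  have hf := (lp.memℓp f).summable (by norm_num)
  refine memℓp_gen ?_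
  refine Summable.of_nonneg_of_le (fun n => by positivity) (fun n => ?_)
    (hf.mul_left (M ^ (2 : ℝ≥0∞).toReal))
  rw [← Real.mul_rpow hM (norm_nonneg _)]
  exact Real.rpow_le_rpow (norm_nonneg _) (h n) (by norm_num)

theorem norm_le_of_bound {G G' : ℕ → Type*} [∀ n, NormedAddCommGroup (G n)]
    [∀ n, NormedAddCommGroup (G' n)] {M : ℝ} (hM : 0 ≤ M)
    (f : lp G 2) (g : lp G' 2) (h : ∀ n, ‖g n‖ ≤ M * ‖f n‖) : ‖g‖ ≤ M * ‖f‖ := by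
  have hf := (lp.memℓp f).summable (by norm_num)
  have hg := (lp.memℓp g).summable (by norm_num)
  have h2 : (0 : ℝ) < (2 : ℝ≥0∞).toReal := by norm_num
  rw [← Real.rpow_le_rpow_iff (norm_nonneg _) (by positivity) h2,
    Real.mul_rpow hM (norm_nonneg _), lp.norm_rpow_eq_tsum h2, lp.norm_rpow_eq_tsum h2,
    ← tsum_mul_left]
  refine hg.tsum_le_tsum (fun n => ?_) (hf.mul_left _)
  rw [← Real.mul_rpow hM (norm_nonneg _)]
  exact Real.rpow_le_rpow (norm_nonneg _) (h n) h2.le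

variable {G : ℕ → Type u} [∀ n, NormedAddCommGroup (G n)] [∀ n, InnerProductSpace ℂ (G n)]

/-- The diagonal operator `(f 0, f 1, …) ↦ (T 0 (f 0), T 1 (f 1), …)` on a Hilbert sum. -/
noncomputable def diagonal (T : ∀ n, G n →L[ℂ] G n) (M : ℝ) (hT : ∀ n, ‖T n‖ ≤ M) :
    lp G 2 →L[ℂ] lp G 2 :=
  have hM : 0 ≤ M := (norm_nonneg _).trans (hT 0)
  have hb : ∀ (f : lp G 2) n, ‖T n (f n)‖ ≤ M * ‖f n‖ := fun f n =>
    ((T n).le_opNorm _).trans (by gcongr; exact hT n)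
  LinearMap.mkContinuous
    { toFun := fun f => ⟨fun n => T n (f n), memℓp_of_bound hM f _ (hb f)⟩
      map_add' := fun f g => by ext n; exact map_add (T n) (f n) (g n)
      map_smul' := fun c f => by ext n; simp }
    M (fun f => norm_le_of_bound hM f _ (hb f))

@[simp] theorem diagonal_apply (T : ∀ n, G n →L[ℂ] G n) (M : ℝ) (hT : ∀ n, ‖T n‖ ≤ M)
    (f : lp G 2) (n : ℕ) : diagonal T M hT f n = T n (f n) := rfl

/-- The sequence `(0, T 0 (f 0), T 1 (f 1), …)`. -/
def shiftFun (T : ∀ n, G n →L[ℂ] G (n + 1)) (f : ∀ n, G n) : ∀ n, G n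
  | 0 => 0
  | n + 1 => T n (f n)

theorem memℓp_shiftFun (T : ∀ n, G n →L[ℂ] G (n + 1)) (M : ℝ) (hT : ∀ n, ‖T n‖ ≤ M)
    (f : lp G 2) : Memℓp (shiftFun T f) 2 := by
  have hM : 0 ≤ M := (norm_nonneg _).trans (hT 0)
  have h1 := (memℓp_of_bound (G' := fun n => G (n + 1)) hM f (fun n => T n (f n)) fun n =>
    ((T n).le_opNorm _).trans (by gcongr; exact hT n)).summable (by norm_num)
  refine memℓp_gen ?_
  rw [← summable_nat_add_iff 1]
  exact h1

/-- The subdiagonal operator `(f 0, f 1, …) ↦ (0, T 0 (f 0), T 1 (f 1), …)` on a Hilbert sum. -/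
noncomputable def subdiagonal (T : ∀ n, G n →L[ℂ] G (n + 1)) (M : ℝ) (hT : ∀ n, ‖T n‖ ≤ M) :
    lp G 2 →L[ℂ] lp G 2 :=
  LinearMap.mkContinuous
    { toFun := fun f => ⟨shiftFun T f, memℓp_shiftFun T M hT f⟩
      map_add' := fun f g => by
        ext n
        cases n with
        | zero => exact (add_zero _).symm
        | succ n => exact map_add (T n) (f n) (g n)
      map_smul' := fun c f => by ext n; cases n <;> simp [shiftFun] }
    M (fun f => by
      have hM : 0 ≤ M := (norm_nonneg _).trans (hT 0)
      have hb : ∀ n, ‖T n (f n)‖ ≤ M * ‖f n‖ := fun n =>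
        ((T n).le_opNorm _).trans (by gcongr; exact hT n)
      have h2 : (0 : ℝ) < (2 : ℝ≥0∞).toReal := by norm_num
      let g : lp (fun n => G (n + 1)) 2 := ⟨fun n => T n (f n), memℓp_of_bound hM f _ hb⟩
      have hg : ‖g‖ ≤ M * ‖f‖ := norm_le_of_bound hM f g hb
      refine le_trans (le_of_eq ?_) hg
      rw [← Real.rpow_left_inj (norm_nonneg _) (norm_nonneg _) h2.ne', lp.norm_rpow_eq_tsum h2,
        lp.norm_rpow_eq_tsum h2]
      refine (Summable.tsum_eq_zero_add ((memℓp_shiftFun T M hT f).summable h2)).trans ?_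
      simp [shiftFun, g])

@[simp] theorem subdiagonal_apply_zero (T : ∀ n, G n →L[ℂ] G (n + 1)) (M : ℝ)
    (hT : ∀ n, ‖T n‖ ≤ M) (f : lp G 2) : subdiagonal T M hT f 0 = 0 := rfl

@[simp] theorem subdiagonal_apply_succ (T : ∀ n, G n →L[ℂ] G (n + 1)) (M : ℝ)
    (hT : ∀ n, ‖T n‖ ≤ M) (f : lp G 2) (n : ℕ) :
    subdiagonal T M hT f (n + 1) = T n (f n) := rfl

end DirectSum

section WStar

open HilbertModule

/-- A realization of `A` as a von Neumann algebra on the Hilbert space `H`: a faithful unital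
`*`-representation whose image equals its bicommutant. With this datum `A` is a von Neumann algebra
in its standard sense. -/
structure VonNeumannRep (A : Type v) (H : Type u) [CStarAlgebra A]
    [NormedAddCommGroup H] [InnerProductSpace ℂ H] [CompleteSpace H] where
  rep : A →⋆ₐ[ℂ] (H →L[ℂ] H)
  injective : Function.Injective rep
  bicommutant : Set.centralizer (Set.centralizer (Set.range rep)) = Set.range rep

/-- The norm-closed linear span of a set of bounded functionals. -/
noncomputable def predual {M : Type*} [NormedAddCommGroup M] [NormedSpace ℂ M] (S : Set (StrongDual ℂ M)) :
    Submodule ℂ (StrongDual ℂ M) :=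
  (Submodule.span ℂ S).topologicalClosure

/-- The coarsest topology making every functional in the norm-closed linear span of `S` continuous.
When this span is the predual, it is the weak-`*` topology. -/
@[reducible] noncomputable def weakStarTopology {M : Type*} [NormedAddCommGroup M] [NormedSpace ℂ M]
    (S : Set (StrongDual ℂ M)) : TopologicalSpace M :=
  ⨅ f : predual S, TopologicalSpace.induced (fun m => (f : StrongDual ℂ M) m) inferInstance

variable {A : Type v} [CStarAlgebra A] [PartialOrder A]

/-- The algebra `L^a(X)` of adjointable operators on a Hilbert module `X`, as a subalgebra of the
bounded operators. -/
def adjointableSubalgebra (A : Type v) (X : Type u) [CStarAlgebra A] [PartialOrder A]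
    [NormedAddCommGroup X] [NormedSpace ℂ X] [Module Aᵐᵒᵖ X] [HilbertModule A X] :
    Subalgebra ℂ (X →L[ℂ] X) where
  carrier := {T | ∃ S : X →L[ℂ] X, ∀ x y, ip (A := A) (T x) y = ip x (S y)}
  mul_mem' := by
    rintro T T' ⟨S, hS⟩ ⟨S', hS'⟩
    exact ⟨S' * S, fun x y => by rw [mul_apply_eq_comp, mul_apply_eq_comp, hS, hS']⟩
  add_mem' := by
    rintro T T' ⟨S, hS⟩ ⟨S', hS'⟩
    exact ⟨S + S', fun x y => by rw [add_apply, add_apply, ip_add_left, ip_add_right, hS, hS']⟩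
  algebraMap_mem' c := ⟨algebraMap ℂ _ (star c), fun x y => by
    simp [Algebra.algebraMap_eq_smul_one, ip_smul_left, ip_smul_right]⟩

/-- The algebra `L^a(X)` of adjointable operators as a type (a definition of its own, which keeps
elaboration fast). -/
def Adjointable (A : Type v) (X : Type u) [CStarAlgebra A] [PartialOrder A]
    [NormedAddCommGroup X] [NormedSpace ℂ X] [Module Aᵐᵒᵖ X] [HilbertModule A X] : Type u :=
  adjointableSubalgebra A X

section AdjointableInstances

variable (X : Type u) [NormedAddCommGroup X] [NormedSpace ℂ X] [Module Aᵐᵒᵖ X] [HilbertModule A X]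

noncomputable instance : NormedRing (Adjointable A X) :=
  inferInstanceAs (NormedRing (adjointableSubalgebra A X))
noncomputable instance : NormedAlgebra ℂ (Adjointable A X) :=
  inferInstanceAs (NormedAlgebra ℂ (adjointableSubalgebra A X))

variable {X}

/-- The underlying bounded operator. -/
def Adjointable.op (T : Adjointable A X) : X →L[ℂ] X := T.1

/-- An adjointable operator from a pair of mutually adjoint bounded operators. -/
def Adjointable.mk (T S : X →L[ℂ] X) (h : ∀ x y, ip (A := A) (T x) y = ip x (S y)) :
    Adjointable A X := ⟨T, S, h⟩

theorem Adjointable.exists_adjoint (T : Adjointable A X) :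
    ∃ S : X →L[ℂ] X, ∀ x y, ip (A := A) (T.op x) y = ip x (S y) := T.2

theorem Adjointable.ext {S T : Adjointable A X} (h : S.op = T.op) : S = T := Subtype.ext h

theorem Adjointable.op_mk (T S : X →L[ℂ] X) (h : ∀ x y, ip (A := A) (T x) y = ip x (S y)) :
    (Adjointable.mk T S h).op = T := rfl

theorem Adjointable.op_mul (S T : Adjointable A X) (x : X) : (S * T).op x = S.op (T.op x) := rfl

theorem Adjointable.op_one (x : X) : (1 : Adjointable A X).op x = x := rfl

theorem Adjointable.op_add (S T : Adjointable A X) (x : X) : (S + T).op x = S.op x + T.op x := rfl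

theorem Adjointable.op_smul (c : ℂ) (T : Adjointable A X) (x : X) :
    (c • T).op x = c • T.op x := rfl

theorem Adjointable.norm_op (T : Adjointable A X) : ‖T.op‖ = ‖T‖ := rfl

end AdjointableInstances

variable {H : Type u} [NormedAddCommGroup H] [InnerProductSpace ℂ H] [CompleteSpace H]

namespace VonNeumannRep

/-- The vector functional `a ↦ ⟪k, a h⟫` on `A`. -/
noncomputable def functional (V : VonNeumannRep A H) (h k : H) : StrongDual ℂ A :=
  LinearMap.mkContinuous
    { toFun := fun a => ⟪k, V.rep a h⟫_ℂ
      map_add' := fun a b => by rw [map_add, add_apply, inner_add_right]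
      map_smul' := fun c a => by
        rw [map_smul, smul_apply, inner_smul_right, RingHom.id_apply, smul_eq_mul] }
    (‖k‖ * ‖h‖) (fun a => by
      refine (norm_inner_le_norm _ _).trans ?_
      have h1 : ‖V.rep a h‖ ≤ ‖a‖ * ‖h‖ := ((V.rep a).le_opNorm h).trans (by
        gcongr; exact NonUnitalStarAlgHom.norm_apply_le _ _)
      calc ‖k‖ * ‖V.rep a h‖ ≤ ‖k‖ * (‖a‖ * ‖h‖) := by gcongr
        _ = _ := by ring)

/-- The ultraweak (weak-`*`) topology of the von Neumann algebra `A`; the closed span of the vector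
functionals is its predual. -/
@[reducible] noncomputable def ultraweak (V : VonNeumannRep A H) : TopologicalSpace A :=
  weakStarTopology (Set.range fun p : H × H => V.functional p.1 p.2)

variable (X : Type u) [NormedAddCommGroup X] [NormedSpace ℂ X] [Module Aᵐᵒᵖ X]
  [HilbertModule A X]

variable {X} in
theorem norm_ip_le [StarOrderedRing A] (x y : X) : ‖ip (A := A) x y‖ ≤ ‖x‖ * ‖y‖ := by
  have h1 : star (ip (A := A) y x) * ip y x ≤ (‖x‖ ^ 2) • ip (A := A) y y := by
    rcases eq_or_ne x 0 with rfl | hx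
    · simp [ip_zero_right]
    have hx2 : 0 < ‖x‖ ^ 2 := by positivity
    obtain ⟨t, ht⟩ : ∃ t : ℂ, t = ((‖x‖ ^ 2 : ℝ) : ℂ) := ⟨_, rfl⟩
    have hst : star t = t := by rw [ht]; exact Complex.conj_ofReal _
    have h2 : ip x y * ip x x * ip y x ≤ t • (ip x y * ip (A := A) y x) := by
      rw [ht, Complex.coe_smul, HilbertModule.norm_sq_eq (A := A) x, ← star_ip y x]
      exact CStarAlgebra.star_left_conjugate_le_norm_smul (star_ip x x)
    have h0 := ip_self_nonneg (A := A) (MulOpposite.op (ip (A := A) y x) • x - t • y)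
    simp only [ip_sub_left, ip_sub_right, ip_act_left, ip_act_right, ip_smul_left, ip_smul_right,
      star_ip, hst] at h0
    have h3 : 0 ≤ (‖x‖ ^ 2) • ((‖x‖ ^ 2) • ip (A := A) y y - ip x y * ip y x) := by
      rw [← Complex.coe_smul, ← Complex.coe_smul, ← ht, smul_sub]
      rw [← sub_nonneg] at h2
      have h5 := add_nonneg h0 h2
      convert h5 using 1
      simp only [mul_sub, smul_sub, mul_smul_comm, mul_assoc]
      abel
    rw [star_ip]
    have h4 := smul_nonneg (inv_nonneg.mpr hx2.le) h3
    rw [inv_smul_smul₀ hx2.ne'] at h4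
    exact sub_nonneg.mp h4
  have h2 := CStarAlgebra.norm_le_norm_of_nonneg_of_le (star_mul_self_nonneg _) h1
  rw [CStarRing.norm_star_mul_self, norm_smul, ← HilbertModule.norm_sq_eq, norm_pow, norm_norm]
    at h2
  rw [← star_ip, norm_star]
  exact (abs_le_of_sq_le_sq' (by nlinarith) (by positivity)).2

/-- The functional `T ↦ ⟪k, ⟨T x, y⟩ h⟫` on the adjointable operators of `X`. -/
noncomputable def moduleFunctional [StarOrderedRing A] (V : VonNeumannRep A H) (x y : X) (h k : H) :
    StrongDual ℂ (Adjointable A X) :=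
  LinearMap.mkContinuous
    { toFun := fun T => V.functional h k (ip (T.op x) y)
      map_add' := fun S T => by
        rw [← map_add, ← ip_add_left]; rfl
      map_smul' := fun c T => by
        rw [RingHom.id_apply, ← map_smul, ← ip_smul_left]; rfl }
    (‖V.functional h k‖ * (‖x‖ * ‖y‖)) (fun T => by
      refine ((V.functional h k).le_opNorm _).trans ?_
      have h1 : ‖ip (A := A) (T.op x) y‖ ≤ ‖T.op‖ * ‖x‖ * ‖y‖ := (norm_ip_le _ _).trans (by
        gcongr; exact T.op.le_opNorm x)
      calc _ ≤ ‖V.functional h k‖ * (‖T.op‖ * ‖x‖ * ‖y‖) := by gcongr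
        _ = ‖V.functional h k‖ * (‖x‖ * ‖y‖) * ‖T.op‖ := by ring
        _ = _ := rfl)

/-- The weak-`*` topology of `L^a(X)` for a self-dual module `X`; the predual of the `W*`-algebra `L^a(X)`
is the closed span of the functionals `T ↦ f (⟨T x, y⟩)` with `f` ultraweakly continuous on `A`. -/
@[reducible] noncomputable def moduleUltraweak [StarOrderedRing A] (V : VonNeumannRep A H) :
    TopologicalSpace (Adjointable A X) :=
  weakStarTopology (Set.range fun p : (X × X) × (H × H) =>
    V.moduleFunctional X p.1.1 p.1.2 p.2.1 p.2.2)

end VonNeumannRep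

namespace Correspondence
variable {E : Type u} [NormedAddCommGroup E] [NormedSpace ℂ E] [Module Aᵐᵒᵖ E] [HilbertModule A E]

/-- The left action as a map from `A` into `L^a(E)`. -/
noncomputable def leftAdj (C : Correspondence A E) (a : A) : Adjointable A E :=
  .mk (C.left a) (C.left (star a)) (C.ip_left a)

end Correspondence

/-- A `W*`-correspondence over the von Neumann algebra `A`: a correspondence whose Hilbert module is
complete and self-dual (every bounded right `A`-module map `E → A` is `x ↦ ⟨x, e⟩` for some `e`),
with a normal left action (`A → L^a(E)` is continuous for the weak-`*` topologies). -/
structure WStarCorrespondence [StarOrderedRing A] (V : VonNeumannRep A H) (E : Type u)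
    [NormedAddCommGroup E] [NormedSpace ℂ E] [Module Aᵐᵒᵖ E] [HilbertModule A E]
    extends Correspondence A E where
  complete : CompleteSpace E
  selfDual : ∀ ρ : E →L[ℂ] A, (∀ (x : E) (b : A), ρ (MulOpposite.op b • x) = ρ x * b) →
    ∃ e : E, ∀ x, ρ x = ip x e
  normal : @Continuous A (Adjointable A E) V.ultraweak (V.moduleUltraweak E)
    toCorrespondence.leftAdj

end WStar

namespace VonNeumannRep

variable {A : Type v} [CStarAlgebra A] {H : Type u} [NormedAddCommGroup H] [InnerProductSpace ℂ H]
  [CompleteSpace H]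

/-- The commutant of `A` in the bounded operators on `H`. -/
def commutant (V : VonNeumannRep A H) : Set (H →L[ℂ] H) := Set.centralizer (Set.range V.rep)

theorem star_mem_commutant (V : VonNeumannRep A H) {b : H →L[ℂ] H} (hb : b ∈ V.commutant) :
    star b ∈ V.commutant := by
  rintro _ ⟨a, rfl⟩
  have := congrArg star (hb _ ⟨star a, rfl⟩)
  rw [star_mul, star_mul, ← map_star, star_star] at this
  exact this.symm

/-- The Hilbert space `H` with the given representation; it plays the role of `A ⊗ H`. -/
noncomputable def baseRep (V : VonNeumannRep A H) : HilbertRep.{u} A where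
  space := H
  rep := V.rep.toNonUnitalStarAlgHom

end VonNeumannRep

namespace Correspondence

open HilbertModule

variable {A : Type v} [CStarAlgebra A] [PartialOrder A] [StarOrderedRing A]
  {H : Type u} [NormedAddCommGroup H] [InnerProductSpace ℂ H] [CompleteSpace H]
  {E : Type u} [NormedAddCommGroup E] [NormedSpace ℂ E] [Module Aᵐᵒᵖ E] [HilbertModule A E]
variable (C : Correspondence A E) (V : VonNeumannRep A H)

/-- The Hilbert spaces `E^{⊗n} ⊗ H`, given by `H` for `n = 0` and `E ⊗ (E^{⊗n} ⊗ H)` for `n + 1`. The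
representation of `A` on them is the left action on `E^{⊗n}`, tensored with `I`. -/
noncomputable def level : ℕ → HilbertRep.{u} A
  | 0 => V.baseRep
  | n + 1 => tensorRep C (level n)

/-- The operator `I ⊗ b` on `E^{⊗n} ⊗ H`, for `b` in the commutant of `A`. -/
noncomputable def amplify (b : H →L[ℂ] H) : ∀ n, (C.level V n).space →L[ℂ] (C.level V n).space
  | 0 => b
  | n + 1 => idTensor (amplify b n)

/-- The operator `ξ_n ⊗ ⋯ ⊗ ξ_1 ⊗ h ↦ x ⊗ ξ_n ⊗ ⋯ ⊗ ξ_1 ⊗ h`. -/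
noncomputable def create (x : E) (n : ℕ) : (C.level V n).space →L[ℂ] (C.level V (n + 1)).space :=
  creation (K := C.level V n) x

variable {V} in
theorem amplify_comm {b : H →L[ℂ] H} (hb : b ∈ V.commutant) (n : ℕ) (a : A) :
    C.amplify V b n * (C.level V n).rep a = (C.level V n).rep a * C.amplify V b n := by
  induction n generalizing a with
  | zero => exact (hb _ ⟨a, rfl⟩).symm
  | succ n ih =>
    refine ext_tmul (K := C.level V n) fun x k => ?_
    change idTensor (C.amplify V b n) (leftTensor C a (tmul x k)) =
      leftTensor C a (idTensor (C.amplify V b n) (tmul x k))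
    rw [leftTensor_tmul, idTensor_tmul _ ih, idTensor_tmul _ ih, leftTensor_tmul]

variable {V} in
theorem norm_amplify_le {b : H →L[ℂ] H} (hb : b ∈ V.commutant) (n : ℕ) :
    ‖C.amplify V b n‖ ≤ ‖b‖ := by
  induction n with
  | zero => exact le_rfl
  | succ n ih => exact (norm_idTensor_le _ (C.amplify_comm hb n)).trans ih

variable {V} in
theorem amplify_create {b : H →L[ℂ] H} (hb : b ∈ V.commutant) (x : E) (n : ℕ)
    (k : (C.level V n).space) :
    C.amplify V b (n + 1) (C.create V x n k) = C.create V x n (C.amplify V b n k) :=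
  idTensor_tmul _ (C.amplify_comm hb n) x k

variable {V} in
theorem adjoint_amplify {b : H →L[ℂ] H} (hb : b ∈ V.commutant) (n : ℕ) :
    star (C.amplify V b n) = C.amplify V (star b) n := by
  induction n with
  | zero => rfl
  | succ n ih =>
    have h1 := C.amplify_comm (V.star_mem_commutant hb) n
    rw [← ih] at h1
    refine (star_idTensor (E := E) _ (C.amplify_comm hb n) h1).trans ?_
    rw [ih]
    rfl

/-- The Hilbert space `F²(E) ⊗ H = ⊕ E^{⊗n} ⊗ H`. -/
def FockHilbert : Type u := lp (fun n => (C.level V n).space) 2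

noncomputable instance : NormedAddCommGroup (C.FockHilbert V) :=
  inferInstanceAs (NormedAddCommGroup (lp (fun n => (C.level V n).space) 2))
noncomputable instance : InnerProductSpace ℂ (C.FockHilbert V) :=
  inferInstanceAs (InnerProductSpace ℂ (lp (fun n => (C.level V n).space) 2))
instance : CompleteSpace (C.FockHilbert V) :=
  inferInstanceAs (CompleteSpace (lp (fun n => (C.level V n).space) 2))

/-- The diagonal operator `⊕ (φ^{(n)}(a) ⊗ I_H)`. -/
noncomputable def fockLeft (a : A) : C.FockHilbert V →L[ℂ] C.FockHilbert V :=
  diagonal (G := fun n => (C.level V n).space) (fun n => (C.level V n).rep a) ‖a‖ fun _ => NonUnitalStarAlgHom.norm_apply_le _ _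

/-- The creation operator of `x`, tensored with `I_H`. -/
noncomputable def fockCreate (x : E) : C.FockHilbert V →L[ℂ] C.FockHilbert V :=
  subdiagonal (G := fun n => (C.level V n).space) (fun n => C.create V x n) ‖x‖ fun _ => norm_creation_le _

/-- The operator `I ⊗ b` on `F²(E) ⊗ H`, for `b` in the commutant of `A`. -/
noncomputable def fockAmplify (b : V.commutant) : C.FockHilbert V →L[ℂ] C.FockHilbert V :=
  diagonal (G := fun n => (C.level V n).space) (fun n => C.amplify V b.1 n) ‖b.1‖ (C.norm_amplify_le b.2)

/-- The operators `H → F²(E) ⊗ H` that intertwine `b` and `I ⊗ b`, for all `b` in the commutant of `A`. -/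
noncomputable def fockSubmodule : Submodule ℂ (H →L[ℂ] C.FockHilbert V) where
  carrier := {x | ∀ b : V.commutant, x ∘L b.1 = C.fockAmplify V b ∘L x}
  add_mem' hx hy b := by
    rw [ContinuousLinearMap.add_comp, ContinuousLinearMap.comp_add, hx b, hy b]
  zero_mem' b := by simp
  smul_mem' c x hx b := by
    rw [ContinuousLinearMap.smul_comp, ContinuousLinearMap.comp_smul, hx b]

/-- The Fock space `F²(E) = ⊕ E^{⊗n}` as a self-dual right Hilbert module over `A` (tensor powers and
infinite sum taken in the sense of `W*`-modules, that is, self-dually completed). An element `x`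
is identified with the operator `h ↦ x ⊗ h` from `H` to `F²(E) ⊗ H`; the operators that arise in
this way are exactly those intertwining `b` and `I ⊗ b` for all `b` in the commutant of `A`. -/
def Fock : Type u := C.fockSubmodule V

noncomputable instance : NormedAddCommGroup (C.Fock V) :=
  inferInstanceAs (NormedAddCommGroup (C.fockSubmodule V))
noncomputable instance : NormedSpace ℂ (C.Fock V) :=
  inferInstanceAs (NormedSpace ℂ (C.fockSubmodule V))

variable {C V}

/-- The operator `h ↦ x ⊗ h` of an element `x` of the Fock space. -/
def Fock.op (x : C.Fock V) : H →L[ℂ] C.FockHilbert V := x.1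

/-- The element of the Fock space given by an intertwining operator. -/
def Fock.mk (x : H →L[ℂ] C.FockHilbert V)
    (hx : ∀ b : V.commutant, x ∘L b.1 = C.fockAmplify V b ∘L x) : C.Fock V := ⟨x, hx⟩

theorem Fock.op_comm (x : C.Fock V) (b : V.commutant) :
    x.op ∘L b.1 = C.fockAmplify V b ∘L x.op := x.2 b

theorem Fock.ext {x y : C.Fock V} (h : x.op = y.op) : x = y := Subtype.ext h

theorem Fock.op_mk (x : H →L[ℂ] C.FockHilbert V)
    (hx : ∀ b : V.commutant, x ∘L b.1 = C.fockAmplify V b ∘L x) : (Fock.mk x hx).op = x := rfl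

theorem Fock.op_add (x y : C.Fock V) : (x + y).op = x.op + y.op := rfl

theorem Fock.op_smul (c : ℂ) (x : C.Fock V) : (c • x).op = c • x.op := rfl

theorem Fock.op_zero : (0 : C.Fock V).op = 0 := rfl

theorem Fock.norm_op (x : C.Fock V) : ‖x.op‖ = ‖x‖ := rfl

variable (C V)

theorem adjoint_fockAmplify (b : V.commutant) :
    (C.fockAmplify V b).adjoint = C.fockAmplify V ⟨star b.1, V.star_mem_commutant b.2⟩ := by
  symm
  rw [ContinuousLinearMap.eq_adjoint_iff]
  intro f g
  refine (lp.inner_eq_tsum (𝕜 := ℂ) (G := fun n => (C.level V n).space) _ _).trans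
    ((tsum_congr fun n => ?_).trans
      (lp.inner_eq_tsum (𝕜 := ℂ) (G := fun n => (C.level V n).space) _ _).symm)
  change ⟪C.amplify V (star b.1) n (f.1 n), g.1 n⟫_ℂ = ⟪f.1 n, C.amplify V b.1 n (g.1 n)⟫_ℂ
  rw [← C.adjoint_amplify b.2, ContinuousLinearMap.star_eq_adjoint,
    ContinuousLinearMap.adjoint_inner_left]

variable {C V}

theorem exists_ip (x y : C.Fock V) : ∃ a : A, V.rep a = y.op.adjoint ∘L x.op := by
  have : y.op.adjoint ∘L x.op ∈ Set.range V.rep := by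
    rw [← V.bicommutant]
    intro b hb
    have hx := x.op_comm ⟨b, hb⟩
    have hy := y.op_comm ⟨star b, V.star_mem_commutant hb⟩
    have hy' := congrArg ContinuousLinearMap.adjoint hy
    rw [ContinuousLinearMap.adjoint_comp, ContinuousLinearMap.adjoint_comp,
      adjoint_fockAmplify] at hy'
    simp only [star_star] at hy'
    change b ∘L (y.op.adjoint ∘L x.op) = (y.op.adjoint ∘L x.op) ∘L b
    rw [ContinuousLinearMap.comp_assoc, hx, ← ContinuousLinearMap.comp_assoc,
      ← ContinuousLinearMap.comp_assoc, ← hy', ContinuousLinearMap.star_eq_adjoint,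
      ContinuousLinearMap.adjoint_adjoint]
  exact this

/-- The inner product `⟨x, y⟩` of the Fock space: the element of `A` that is represented on `H` by the
operator `y* x`. -/
noncomputable def fockIp (x y : C.Fock V) : A := Classical.choose (exists_ip x y)

theorem rep_fockIp (x y : C.Fock V) : V.rep (fockIp x y) = y.op.adjoint ∘L x.op :=
  Classical.choose_spec (exists_ip x y)

theorem commutant_comm (b : V.commutant) (a : A) : V.rep a ∘L b.1 = b.1 ∘L V.rep a :=
  b.2 _ ⟨a, rfl⟩

/-- The right action `x · a`, represented by the operator `h ↦ x ⊗ a h`. -/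
noncomputable instance : SMul Aᵐᵒᵖ (C.Fock V) where
  smul a x := .mk (x.op ∘L V.rep a.unop) fun b => by
    rw [ContinuousLinearMap.comp_assoc, commutant_comm, ← ContinuousLinearMap.comp_assoc, x.op_comm b,
      ContinuousLinearMap.comp_assoc]

theorem op_act (a : A) (x : C.Fock V) :
    (MulOpposite.op a • x : C.Fock V).op = x.op ∘L V.rep a := rfl

noncomputable instance : Module Aᵐᵒᵖ (C.Fock V) where
  one_smul x := Fock.ext (by
    change x.op ∘L V.rep 1 = x.op
    rw [map_one]; rfl)
  mul_smul a b x := Fock.ext (by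
    change x.op ∘L V.rep (b.unop * a.unop) = (x.op ∘L V.rep b.unop) ∘L V.rep a.unop
    rw [map_mul]; rfl)
  smul_zero a := Fock.ext (by
    change (0 : H →L[ℂ] C.FockHilbert V) ∘L V.rep a.unop = 0
    simp)
  smul_add a x y := Fock.ext (by
    change (x.op + y.op) ∘L V.rep a.unop = x.op ∘L V.rep a.unop + y.op ∘L V.rep a.unop
    simp [ContinuousLinearMap.add_comp])
  add_smul a b x := Fock.ext (by
    change x.op ∘L V.rep (a.unop + b.unop) = x.op ∘L V.rep a.unop + x.op ∘L V.rep b.unop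
    rw [map_add, ContinuousLinearMap.comp_add])
  zero_smul x := Fock.ext (by
    change x.op ∘L V.rep 0 = 0
    simp)

noncomputable instance : HilbertModule A (C.Fock V) where
  ip := fockIp
  ip_add_left x y z := V.injective (by
    rw [map_add, rep_fockIp, rep_fockIp, rep_fockIp, Fock.op_add,
      ContinuousLinearMap.comp_add])
  ip_smul_left c x y := V.injective (by
    rw [map_smul, rep_fockIp, rep_fockIp, Fock.op_smul, ContinuousLinearMap.comp_smul])
  ip_act_left b x y := V.injective (by
    rw [map_mul, rep_fockIp, rep_fockIp, op_act]; rfl)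
  star_ip x y := V.injective (by
    rw [map_star, rep_fockIp, rep_fockIp, ContinuousLinearMap.star_eq_adjoint,
      ContinuousLinearMap.adjoint_comp, ContinuousLinearMap.adjoint_adjoint])
  ip_self_nonneg x := by
    have h1 : IsSelfAdjoint (fockIp x x) := V.injective (by
      rw [map_star, rep_fockIp, ContinuousLinearMap.star_eq_adjoint,
        ContinuousLinearMap.adjoint_comp, ContinuousLinearMap.adjoint_adjoint])
    have h2 : 0 ≤ V.rep (fockIp x x) := by
      rw [rep_fockIp, ContinuousLinearMap.nonneg_iff_isPositive]
      exact ContinuousLinearMap.isPositive_adjoint_comp_self _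
    rw [StarOrderedRing.nonneg_iff_spectrum_nonneg (R := ℝ) _ h1,
      ← h1.map_spectrum_real V.rep V.injective]
    exact fun r hr => spectrum_nonneg_of_nonneg h2 hr
  eq_zero_of_ip_self x hx := by
    have h1 := rep_fockIp x x
    rw [show fockIp x x = 0 from hx, map_zero] at h1
    refine Fock.ext (ContinuousLinearMap.ext fun h => ?_)
    have h2 := congrArg (fun T => ⟪h, T h⟫_ℂ) h1
    simp only [ContinuousLinearMap.comp_apply, ContinuousLinearMap.adjoint_inner_right] at h2
    simpa [Fock.op_zero] using h2.symm
  norm_sq_eq x := by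
    have h1 : ‖V.rep (fockIp x x)‖ = ‖fockIp x x‖ :=
      NonUnitalStarAlgHom.norm_map V.rep V.injective _
    rw [← h1, rep_fockIp, ContinuousLinearMap.norm_adjoint_comp_self, sq]
    rfl

end Correspondence

namespace Correspondence

open HilbertModule

variable {A : Type v} [CStarAlgebra A] [PartialOrder A] [StarOrderedRing A]
  {H : Type u} [NormedAddCommGroup H] [InnerProductSpace ℂ H] [CompleteSpace H]
  {E : Type u} [NormedAddCommGroup E] [NormedSpace ℂ E] [Module Aᵐᵒᵖ E] [HilbertModule A E]
variable {C : Correspondence A E} {V : VonNeumannRep A H}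

/-- Left multiplication of elements of the Fock space by an operator `T` on `F²(E) ⊗ H`. -/
noncomputable def fockOpCLM (T : C.FockHilbert V →L[ℂ] C.FockHilbert V)
    (hT : ∀ b, T ∘L C.fockAmplify V b = C.fockAmplify V b ∘L T) : C.Fock V →L[ℂ] C.Fock V :=
  LinearMap.mkContinuous
    { toFun := fun x => .mk (T ∘L x.op) fun b => by
        rw [ContinuousLinearMap.comp_assoc, x.op_comm b, ← ContinuousLinearMap.comp_assoc, hT,
          ContinuousLinearMap.comp_assoc]
      map_add' := fun x y => Fock.ext (ContinuousLinearMap.comp_add T x.op y.op)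
      map_smul' := fun c x => Fock.ext (ContinuousLinearMap.comp_smul T c x.op) }
    ‖T‖ (fun x => ContinuousLinearMap.opNorm_comp_le T x.op)

theorem op_fockOpCLM (T : C.FockHilbert V →L[ℂ] C.FockHilbert V)
    (hT : ∀ b, T ∘L C.fockAmplify V b = C.fockAmplify V b ∘L T) (x : C.Fock V) :
    (fockOpCLM T hT x).op = T ∘L x.op := rfl

theorem adjoint_comm {T : C.FockHilbert V →L[ℂ] C.FockHilbert V}
    (hT : ∀ b, T ∘L C.fockAmplify V b = C.fockAmplify V b ∘L T) (b : V.commutant) :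
    T.adjoint ∘L C.fockAmplify V b = C.fockAmplify V b ∘L T.adjoint := by
  have h := congrArg ContinuousLinearMap.adjoint (hT ⟨star b.1, V.star_mem_commutant b.2⟩)
  rw [ContinuousLinearMap.adjoint_comp, ContinuousLinearMap.adjoint_comp,
    adjoint_fockAmplify] at h
  simp only [star_star] at h
  exact h.symm

/-- An operator on `F²(E) ⊗ H` commuting with all `I ⊗ b` acts on the Fock space by an adjointable
operator. -/
noncomputable def fockOp (T : C.FockHilbert V →L[ℂ] C.FockHilbert V)
    (hT : ∀ b, T ∘L C.fockAmplify V b = C.fockAmplify V b ∘L T) : Adjointable A (C.Fock V) :=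
  .mk (fockOpCLM T hT) (fockOpCLM T.adjoint (adjoint_comm hT)) fun x y => V.injective (by
    change V.rep (fockIp _ _) = V.rep (fockIp _ _)
    rw [rep_fockIp, rep_fockIp, op_fockOpCLM, op_fockOpCLM, ContinuousLinearMap.adjoint_comp,
      ContinuousLinearMap.adjoint_adjoint]
    rfl)

variable (C V)

theorem fockLeft_comm (a : A) (b : V.commutant) :
    C.fockLeft V a ∘L C.fockAmplify V b = C.fockAmplify V b ∘L C.fockLeft V a := by
  refine ContinuousLinearMap.ext fun f => lp.ext (funext fun n => ?_)
  exact congrArg (fun T => T (f.1 n)) (C.amplify_comm b.2 n a).symm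

theorem fockCreate_comm (x : E) (b : V.commutant) :
    C.fockCreate V x ∘L C.fockAmplify V b = C.fockAmplify V b ∘L C.fockCreate V x := by
  refine ContinuousLinearMap.ext fun f => lp.ext (funext fun n => ?_)
  cases n with
  | zero => exact (map_zero (C.amplify V b.1 0)).symm
  | succ n => exact (C.amplify_create b.2 x n (f.1 n)).symm

/-- The left action `φ_∞(a) = diag(a, φ^{(1)}(a), φ^{(2)}(a), …)` of `A` on the Fock space. -/
noncomputable def phiInfty (a : A) : Adjointable A (C.Fock V) :=
  fockOp (C.fockLeft V a) (C.fockLeft_comm V a)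

/-- The creation operator `T_ξ : ξ_n ⊗ ⋯ ⊗ ξ_1 ↦ ξ ⊗ ξ_n ⊗ ⋯ ⊗ ξ_1` on the Fock space. -/
noncomputable def creationOp (x : E) : Adjointable A (C.Fock V) :=
  fockOp (C.fockCreate V x) (C.fockCreate_comm V x)

/-- The Toeplitz algebra `F^∞(E)`: the smallest weak-`*` closed subalgebra of `L^a(F²(E))` that contains
all `φ_∞(a)` and all `T_ξ`. -/
noncomputable def toeplitzAlgebra : NonUnitalSubalgebra ℂ (Adjointable A (C.Fock V)) :=
  sInf {S | (∀ a, C.phiInfty V a ∈ S) ∧ (∀ x, C.creationOp V x ∈ S) ∧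
    @IsClosed _ (V.moduleUltraweak (C.Fock V)) (S : Set (Adjointable A (C.Fock V)))}

/-- The unit of `A`, as the element `(1, 0, 0, …)` of the Fock space. -/
noncomputable def vacuum : C.Fock V :=
  .mk (LinearMap.mkContinuous
    { toFun := fun h => (lp.single 2 0 (h : (C.level V 0).space) :
        lp (fun n => (C.level V n).space) 2)
      map_add' := fun h k => lp.single_add (E := fun n => (C.level V n).space) 2 0 h k
      map_smul' := fun c h => lp.single_smul (E := fun n => (C.level V n).space) 2 0 c h }
    1 (fun h => by
      rw [one_mul]
      exact (lp.norm_single (E := fun n => (C.level V n).space) (by norm_num) 0 h).le)) fun b => by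
    refine ContinuousLinearMap.ext fun h => lp.ext (funext fun n => ?_)
    cases n with
    | zero =>
      refine (lp.single_apply_self (E := fun n => (C.level V n).space) 2 0 (b.1 h)).trans ?_
      exact congrArg b.1 (lp.single_apply_self (E := fun n => (C.level V n).space) 2 0 h).symm
    | succ n =>
      have h0 : ∀ k : H, lp.single (E := fun n => (C.level V n).space) 2 0 k (n + 1) = 0 :=
        fun k => lp.single_apply_ne (E := fun n => (C.level V n).space) 2 0 k (Nat.succ_ne_zero n)
      refine (h0 (b.1 h)).trans ?_
      exact ((congrArg (C.amplify V b.1 (n + 1)) (h0 h)).trans (map_zero _)).symm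

/-- The embedding `a ↦ (a, 0, 0, …)` of `A` in the Fock space, as the summand of degree zero. -/
noncomputable def inclusion (a : A) : C.Fock V := MulOpposite.op a • C.vacuum V

/-- The operator `h ↦ z ⊗ ⋯ ⊗ z ⊗ h` with `n` factors `z`; it represents `z^{⊗n}`. -/
noncomputable def tensorPower (z : E) : ∀ n, H →L[ℂ] (C.level V n).space
  | 0 => ContinuousLinearMap.id ℂ H
  | n + 1 => C.create V z n ∘L tensorPower z n

theorem norm_tensorPower_apply_le (z : E) (n : ℕ) (h : H) :
    ‖C.tensorPower V z n h‖ ≤ ‖h‖ * ‖(‖z‖ ^ n : ℝ)‖ := by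
  rw [norm_pow, norm_norm]
  induction n with
  | zero => simp [tensorPower]; exact le_rfl
  | succ n ih =>
    calc ‖C.create V z n (C.tensorPower V z n h)‖ ≤ ‖z‖ * ‖C.tensorPower V z n h‖ :=
          ((C.create V z n).le_opNorm _).trans (by gcongr; exact norm_creation_le z)
      _ ≤ ‖z‖ * (‖h‖ * ‖z‖ ^ n) := by gcongr
      _ = _ := by ring

theorem amplify_tensorPower (b : V.commutant) (z : E) (n : ℕ) (h : H) :
    C.amplify V b.1 n (C.tensorPower V z n h) = C.tensorPower V z n (b.1 h) := by
  induction n with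
  | zero => rfl
  | succ n ih =>
    refine (C.amplify_create b.2 z n _).trans ?_
    exact congrArg (C.create V z n) ih

/-- The sequence of powers of a number in `[0, 1)`. -/
noncomputable def geometric (r : Set.Ico (0 : ℝ) 1) : lp (fun _ : ℕ => ℝ) 2 :=
  ⟨fun n => r.1 ^ n, memℓp_gen (by
    have h2 : r.1 ^ 2 < 1 := pow_lt_one₀ r.2.1 r.2.2 two_ne_zero
    refine (summable_geometric_of_lt_one (sq_nonneg r.1) h2).congr fun n => ?_
    rw [ENNReal.toReal_ofNat, Real.rpow_two, norm_pow, Real.norm_of_nonneg r.2.1, ← pow_mul,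
      ← pow_mul, mul_comm])⟩

/-- The element `(1, z, z ⊗ z, …)` of the Fock space, for `z` in the open unit ball of `E`. -/
noncomputable def geometricSeries (z : Metric.ball (0 : E) 1) : C.Fock V :=
  have hz : ‖z.1‖ ∈ Set.Ico (0 : ℝ) 1 := ⟨norm_nonneg _, mem_ball_zero_iff.mp z.2⟩
  .mk (LinearMap.mkContinuous
    { toFun := fun h => (⟨fun n => C.tensorPower V z.1 n h,
        memℓp_of_bound (norm_nonneg h) (geometric ⟨_, hz⟩) _
          (fun n => C.norm_tensorPower_apply_le V z.1 n h)⟩ :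
        lp (fun n => (C.level V n).space) 2)
      map_add' := fun h k => lp.ext (funext fun n => map_add (C.tensorPower V z.1 n) h k)
      map_smul' := fun c h => lp.ext (funext fun n => map_smul (C.tensorPower V z.1 n) c h) }
    ‖geometric ⟨_, hz⟩‖ (fun h => by
      rw [mul_comm]
      exact norm_le_of_bound (norm_nonneg h) (geometric ⟨_, hz⟩) _
          (fun n => C.norm_tensorPower_apply_le V z.1 n h))) fun b =>
    ContinuousLinearMap.ext fun h => lp.ext (funext fun n =>
      (C.amplify_tensorPower V b z.1 n h).symm)

/-- The operator `W : A → F²(E)` of the pair `(ζ, a)`, where `z = ζ*`: it is `φ_∞(a*)` times the column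
with entries `b ↦ z^{⊗n} · b`. -/
noncomputable def poisson (z : Metric.ball (0 : E) 1) (a b : A) : C.Fock V :=
  (C.phiInfty V (star a)).op (MulOpposite.op b • C.geometricSeries V z)

/-- The adjoint of `W : A → F²(E)`, given by `x ↦ ⟨x, W 1⟩`; see `ip_poisson` for the adjointness. -/
noncomputable def poissonAdjoint (z : Metric.ball (0 : E) 1) (a : A) (x : C.Fock V) : A :=
  ip x (C.poisson V z a 1)

theorem poisson_eq (z : Metric.ball (0 : E) 1) (a b : A) :
    C.poisson V z a b = MulOpposite.op b • C.poisson V z a 1 := by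
  rw [poisson, poisson, MulOpposite.op_one, one_smul]
  exact Fock.ext rfl

/-- The maps `poisson` and `poissonAdjoint` are adjoint to each other. -/
theorem ip_poisson (z : Metric.ball (0 : E) 1) (a b : A) (x : C.Fock V) :
    ip (A := A) (C.poisson V z a b) x = ip b (C.poissonAdjoint V z a x) := by
  change _ = star (C.poissonAdjoint V z a x) * b
  rw [poisson_eq, ip_act_left, poissonAdjoint, star_ip]

/-- The value of `R` at the point `(ζ, a)`, where `z = ζ*`: the adjointable operator `W* R`, restricted to
the summand `A` of the Fock space, is left multiplication by an element of `A` (see `pointEval_act`),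
namely by its value at `1`. -/
noncomputable def pointEval (R : C.toeplitzAlgebra V) (z : Metric.ball (0 : E) 1) (a : A) : A :=
  C.poissonAdjoint V z a (R.1.op (C.inclusion V 1))

theorem adjointable_act {X : Type u} [NormedAddCommGroup X] [NormedSpace ℂ X] [Module Aᵐᵒᵖ X]
    [HilbertModule A X] (T : Adjointable A X) (x : X) (b : A) :
    T.op (MulOpposite.op b • x) = MulOpposite.op b • T.op x := by
  obtain ⟨S, hS⟩ := T.exists_adjoint
  rw [← sub_eq_zero]
  refine eq_zero_of_ip_self (A := A) _ ?_
  simp only [ip_sub_left, ip_act_left, hS, sub_self]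

theorem pointEval_act (R : C.toeplitzAlgebra V) (z : Metric.ball (0 : E) 1) (a b : A) :
    C.poissonAdjoint V z a (R.1.op (C.inclusion V b)) = C.pointEval V R z a * b := by
  have h1 : C.inclusion V b = MulOpposite.op b • C.inclusion V 1 := by
    refine Fock.ext ?_
    change (C.vacuum V).op ∘L V.rep b = ((C.vacuum V).op ∘L V.rep 1) ∘L V.rep b
    rw [map_one]; rfl
  have h2 := adjointable_act R.1 (C.inclusion V 1) b
  exact (congrArg (fun x => ip x (C.poisson V z a 1)) ((congrArg R.1.op h1).trans h2)).trans
    (ip_act_left b _ _)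

end Correspondence

/-! ### Preduals and weak-`*` continuous functionals. -/

section Predual

variable {M N : Type*} [NormedAddCommGroup M] [NormedSpace ℂ M]
  [NormedAddCommGroup N] [NormedSpace ℂ N] {S : Set (StrongDual ℂ M)} {S' : Set (StrongDual ℂ N)}

/-! Write `Ω` for the vacuum and `g = (1, z, z ⊗ z, …)` with `z = ζ*`. Since `W 1 = φ_∞(a*) g`, the
value of `R` at `(ζ, a)` is `⟨φ_∞(a) R Ω, g⟩` (`pointEval_eq`). The point is that the set of vectors
`φ_∞(a*) g` is invariant under the adjoints of all elements of the Toeplitz algebra: `R* φ_∞(a*) g =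
φ_∞(b*) g`. Pairing with `Ω`, which sees only the entry `1` of `g`, forces `b` to be the value of
`R` at `(ζ, a)`. Consequently `⟨φ_∞(a) R S Ω, g⟩ = ⟨φ_∞(b) S Ω, g⟩`, and this is the composition
law.

The invariance is checked on generators. For `φ_∞(c)` one has `b = a c`. For `T_e` one has `φ_∞(a)
T_e = T_{a e}`, and `T_e* g = φ_∞(⟨z, e⟩) g` because `g` reproduces itself when one tensor factor is
removed; hence `b = ⟨a e, z⟩`. Operators with the invariance property form an algebra
(`evaluationAlgebra`), because two successive transfers `a ↦ b` compose.

The analytic part is that this algebra is weak-`*` closed (`isClosed_evaluationAlgebra`). The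
defining identity compares `⟨R x, W 1⟩` with `⟨φ_∞(⟨R Ω, W 1⟩) x, g⟩`. The second expression depends
on `R` through `φ_∞`, so its continuity needs `φ_∞` to be normal. Normality is carried from `φ` to
`E^{⊗n} ⊗ H` by induction on `n` (`matrixCoeff_level_mem`) and then to the Hilbert sum
(`matrixCoeff_fock_mem`), using that preduals are norm closed.

Multiplicativity fails already for `R = S = φ_∞(1)`, whose value and whose square's value at `(ζ,
a)` are both `a`: take `a = 2`. -/

theorem mem_predual {f : StrongDual ℂ M} (hf : f ∈ S) : f ∈ predual S :=
  Submodule.le_topologicalClosure _ (Submodule.subset_span hf)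

theorem isClosed_predual : IsClosed (predual S : Set (StrongDual ℂ M)) :=
  Submodule.isClosed_topologicalClosure _

theorem continuous_of_mem_predual {f : StrongDual ℂ M} (hf : f ∈ predual S) :
    @Continuous M ℂ (weakStarTopology S) _ f :=
  continuous_iInf_dom (i := (⟨f, hf⟩ : predual S)) continuous_induced_dom

/-- A bounded functional that is continuous for the weak-`*` topology belongs to the predual. -/
theorem mem_predual_of_continuous {f : StrongDual ℂ M}
    (hf : @Continuous M ℂ (weakStarTopology S) _ f) : f ∈ predual S := by
  have h := (LinearMap.mem_span_iff_continuous
    (f := fun g : predual S => (g : StrongDual ℂ M).toLinearMap) f.toLinearMap).mpr hf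
  -- A functional continuous for the topology induced by a family lies in the algebraic span of the
  -- family. Here the family is already a subspace, so the span adds nothing.
  have h2 : Submodule.span ℂ (Set.range fun g : predual S => (g : StrongDual ℂ M).toLinearMap) ≤
      (predual S).map (ContinuousLinearMap.coeLM ℂ : StrongDual ℂ M →ₗ[ℂ] M →ₗ[ℂ] ℂ) := by
    rw [Submodule.span_le]
    rintro _ ⟨g, rfl⟩
    exact ⟨g, g.2, rfl⟩
  obtain ⟨g, hg, hgf⟩ := h2 h
  rwa [← ContinuousLinearMap.coe_injective hgf]

/-- Precomposition with `L` is norm continuous, so the functionals it sends into `predual S` form a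
closed subspace; it is enough to test the generators `S'`. -/
theorem comp_mem_predual (L : M →L[ℂ] N) (h : ∀ f ∈ S', f ∘L L ∈ predual S)
    {f : StrongDual ℂ N} (hf : f ∈ predual S') : f ∘L L ∈ predual S := by
  let Φ : StrongDual ℂ N →L[ℂ] StrongDual ℂ M := (ContinuousLinearMap.compL ℂ M N ℂ).flip L
  have h1 : predual S' ≤ (predual S).comap Φ.toLinearMap :=
    Submodule.topologicalClosure_minimal _ (Submodule.span_le.mpr h)
      (isClosed_predual.preimage Φ.continuous)
  exact h1 hf

theorem isClosed_weakStar_eq {f g : StrongDual ℂ M} (hf : f ∈ predual S) (hg : g ∈ predual S) :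
    @IsClosed M (weakStarTopology S) {m | f m = g m} :=
  @isClosed_eq ℂ M _ (weakStarTopology S) _ f g (continuous_of_mem_predual hf)
    (continuous_of_mem_predual hg)

end Predual

/-! ### Matrix coefficients of operator-valued maps. -/

section MatrixCoefficients

variable {M G : Type*} [NormedAddCommGroup M] [NormedSpace ℂ M] [NormedAddCommGroup G]
  [InnerProductSpace ℂ G] {S : Set (StrongDual ℂ M)}

/-- The functional `m ↦ ⟪k, T m h⟫` of a bounded linear map `T` into the operators on a Hilbert
space. -/
noncomputable def matrixCoeff (T : M →L[ℂ] G →L[ℂ] G) (k h : G) : StrongDual ℂ M :=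
  innerSL ℂ k ∘L ContinuousLinearMap.flip T h

theorem matrixCoeff_apply (T : M →L[ℂ] G →L[ℂ] G) (k h : G) (m : M) :
    matrixCoeff T k h m = ⟪k, T m h⟫_ℂ := rfl

/-- The vectors `k` for which `m ↦ ⟪k, T m h⟫` lies in the predual form a closed subspace. -/
noncomputable def leftCoeffSubmodule (S : Set (StrongDual ℂ M)) (T : M →L[ℂ] G →L[ℂ] G) (h : G) :
    Submodule ℂ G where
  carrier := {k | matrixCoeff T k h ∈ predual S}
  add_mem' {k l} hk hl := by
    have : matrixCoeff T (k + l) h = matrixCoeff T k h + matrixCoeff T l h := by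
      ext m; simp [matrixCoeff_apply]
    rw [Set.mem_ofPred_eq, this]
    exact add_mem hk hl
  zero_mem' := by
    have : matrixCoeff T 0 h = 0 := by ext m; simp [matrixCoeff_apply]
    rw [Set.mem_ofPred_eq, this]
    exact zero_mem _
  smul_mem' c k hk := by
    have : matrixCoeff T (c • k) h = star c • matrixCoeff T k h := by
      ext m; simp [matrixCoeff_apply, mul_comm]
    rw [Set.mem_ofPred_eq, this]
    exact Submodule.smul_mem _ _ hk

/-- The coefficient depends norm continuously on `k`, and the predual is norm closed. Normality of
coefficients can therefore be checked on vectors with dense span. -/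
theorem isClosed_leftCoeffSubmodule (T : M →L[ℂ] G →L[ℂ] G) (h : G) :
    IsClosed (leftCoeffSubmodule S T h : Set G) := by
  refine isClosed_predual.preimage (f := fun k => matrixCoeff T k h) ?_
  unfold matrixCoeff
  exact (innerSL ℂ).continuous.clm_comp continuous_const

/-- The vectors `h` for which `m ↦ ⟪k, T m h⟫` lies in the predual form a closed subspace. -/
noncomputable def rightCoeffSubmodule (S : Set (StrongDual ℂ M)) (T : M →L[ℂ] G →L[ℂ] G) (k : G) :
    Submodule ℂ G where
  carrier := {h | matrixCoeff T k h ∈ predual S}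
  add_mem' {h l} hh hl := by
    have : matrixCoeff T k (h + l) = matrixCoeff T k h + matrixCoeff T k l := by
      ext m; simp [matrixCoeff_apply]
    rw [Set.mem_ofPred_eq, this]
    exact add_mem hh hl
  zero_mem' := by
    have : matrixCoeff T k 0 = 0 := by ext m; simp [matrixCoeff_apply]
    rw [Set.mem_ofPred_eq, this]
    exact zero_mem _
  smul_mem' c h hh := by
    have : matrixCoeff T k (c • h) = c • matrixCoeff T k h := by
      ext m; simp [matrixCoeff_apply]
    rw [Set.mem_ofPred_eq, this]
    exact Submodule.smul_mem _ _ hh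

theorem isClosed_rightCoeffSubmodule (T : M →L[ℂ] G →L[ℂ] G) (k : G) :
    IsClosed (rightCoeffSubmodule S T k : Set G) := by
  refine isClosed_predual.preimage (f := fun h => matrixCoeff T k h) ?_
  unfold matrixCoeff
  exact continuous_const.clm_comp (ContinuousLinearMap.flip T).continuous

end MatrixCoefficients

/-! ### Density of elementary tensors. -/

section TensorDensity

variable {A : Type v} [CStarAlgebra A] [PartialOrder A] [StarOrderedRing A]
variable {E : Type u} [NormedAddCommGroup E] [NormedSpace ℂ E] [Module Aᵐᵒᵖ E] [HilbertModule A E]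
variable {K : HilbertRep.{u} A}

/-- A closed subspace of `E ⊗ K` that contains the elementary tensors is the whole space. -/
theorem eq_top_of_tmul_mem {W : Submodule ℂ (TensorSpace E K)}
    (hW : IsClosed (W : Set (TensorSpace E K))) (h : ∀ x k, tmul x k ∈ W) : W = ⊤ := by
  refine Submodule.eq_top_iff'.mpr fun z => ?_
  refine (denseRange_ofPre (E := E) (K := K)).induction ?_ hW z
  rintro _ ⟨f, rfl⟩
  rw [ofPre_eq]
  exact Submodule.sum_mem _ fun p _ => Submodule.smul_mem _ _ (h _ _)

/-- The representation of a `HilbertRep` as a bounded linear map. -/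
noncomputable def HilbertRep.repCLM (K : HilbertRep.{u} A) : A →L[ℂ] K.space →L[ℂ] K.space :=
  LinearMap.mkContinuous
    { toFun := fun a => K.rep a
      map_add' := fun a b => map_add K.rep a b
      map_smul' := fun c a => map_smul K.rep c a }
    1 fun a => by
      rw [one_mul]
      exact NonUnitalStarAlgHom.norm_apply_le K.rep a

end TensorDensity

/-! ### Normality of the left action, from `E` to the Fock space. -/

namespace VonNeumannRep

variable {A : Type v} [CStarAlgebra A]
  {H : Type u} [NormedAddCommGroup H] [InnerProductSpace ℂ H] [CompleteSpace H]

/-- The ultraweakly continuous functionals on `A`. -/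
noncomputable abbrev normalFunctionals (V : VonNeumannRep A H) : Submodule ℂ (StrongDual ℂ A) :=
  predual (Set.range fun p : H × H => V.functional p.1 p.2)

/-- The representation on `H` is faithful, so vector functionals separate points. This turns
`A`-valued identities into scalar ones. -/
theorem eq_of_functional_eq (V : VonNeumannRep A H) {a b : A}
    (hab : ∀ h k, V.functional h k a = V.functional h k b) : a = b :=
  V.injective (ContinuousLinearMap.ext fun h => ext_inner_left ℂ fun k => hab h k)

end VonNeumannRep

section Normality

open HilbertModule

variable {A : Type v} [CStarAlgebra A] [PartialOrder A] [StarOrderedRing A]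
  {H : Type u} [NormedAddCommGroup H] [InnerProductSpace ℂ H] [CompleteSpace H]

/-- The bounded linear map `T ↦ ⟨T x, y⟩` on the adjointable operators. -/
noncomputable def ipCLM {X : Type u} [NormedAddCommGroup X] [NormedSpace ℂ X] [Module Aᵐᵒᵖ X]
    [HilbertModule A X] (x y : X) : Adjointable A X →L[ℂ] A :=
  LinearMap.mkContinuous
    { toFun := fun T => ip (T.op x) y
      map_add' := fun S T => ip_add_left (S.op x) (T.op x) y
      map_smul' := fun c T => ip_smul_left c (T.op x) y }
    (‖x‖ * ‖y‖) fun T => by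
      have h1 : ‖ip (A := A) (T.op x) y‖ ≤ ‖T.op‖ * ‖x‖ * ‖y‖ :=
        (VonNeumannRep.norm_ip_le _ _).trans (by gcongr; exact T.op.le_opNorm x)
      refine h1.trans (le_of_eq ?_)
      rw [Adjointable.norm_op]; ring

namespace VonNeumannRep

variable {X : Type u} [NormedAddCommGroup X] [NormedSpace ℂ X] [Module Aᵐᵒᵖ X] [HilbertModule A X]

/-- For a vector functional `f` the composite is one of the generators of the predual of `L^a(X)`;
`comp_mem_predual` extends this to norm limits. All weak-`*` continuity in the operator variable
comes from here. -/
theorem comp_ipCLM_mem_predual (V : VonNeumannRep A H) (x y : X) {f : StrongDual ℂ A}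
    (hf : f ∈ V.normalFunctionals) :
    f ∘L ipCLM x y ∈ predual (Set.range fun p : (X × X) × (H × H) =>
      V.moduleFunctional X p.1.1 p.1.2 p.2.1 p.2.2) := by
  refine comp_mem_predual _ ?_ hf
  rintro _ ⟨p, rfl⟩
  exact mem_predual ⟨((x, y), p), rfl⟩

end VonNeumannRep

variable {V : VonNeumannRep A H} {E : Type u} [NormedAddCommGroup E] [NormedSpace ℂ E]
  [Module Aᵐᵒᵖ E] [HilbertModule A E]

theorem Correspondence.norm_fockLeft_le (C : Correspondence A E) (V : VonNeumannRep A H) (a : A) :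
    ‖C.fockLeft V a‖ ≤ ‖a‖ := by
  unfold Correspondence.fockLeft diagonal
  exact LinearMap.mkContinuous_norm_le _ (norm_nonneg a) _

namespace WStarCorrespondence

variable (C : WStarCorrespondence V E)

/-- The matrix coefficients of the left action of `A` on `E^{⊗n} ⊗ H` are normal. -/
theorem matrixCoeff_level_mem (n : ℕ) (k h : (C.level V n).space) :
    matrixCoeff (C.level V n).repCLM k h ∈ V.normalFunctionals := by
  induction n with
  | zero => exact mem_predual ⟨(h, k), rfl⟩
  | succ n ih =>
    let T : A →L[ℂ] TensorSpace E (C.level V n) →L[ℂ] TensorSpace E (C.level V n) :=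
      (C.level V (n + 1)).repCLM
    change matrixCoeff T k h ∈ V.normalFunctionals
    have key : ∀ x k' y h', matrixCoeff T (tmul x k') (tmul y h') ∈ V.normalFunctionals := by
      intro x k' y h'
      -- On elementary tensors the coefficient is `c ↦ ⟪k', ⟨c y, x⟩ h'⟫`. By the induction
      -- hypothesis `T ↦ ⟪k', ⟨T y, x⟩ h'⟫` is weak-`*` continuous on `L^a(E)`, and normality of the
      -- left action gives continuity in `c`. That hypothesis speaks of topologies, so membership in
      -- the predual is recovered from continuity.
      refine mem_predual_of_continuous ?_
      have h1 := V.comp_ipCLM_mem_predual y x (ih k' h')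
      have h2 := @Continuous.comp _ _ _ V.ultraweak (V.moduleUltraweak E) _ _ _
        (continuous_of_mem_predual h1) C.normal
      convert h2 using 1
      funext c
      exact inner_leftTensor C.toCorrespondence c y x h' k'
    -- Density is used in one vector at a time: first the right one, with an elementary tensor kept
    -- on the left, then the left one.
    have h1 : ∀ x k', matrixCoeff T (tmul x k') h ∈ V.normalFunctionals := by
      intro x k'
      have := eq_top_of_tmul_mem (isClosed_rightCoeffSubmodule T (tmul x k')) (key x k')
      exact Submodule.eq_top_iff'.mp this h
    have := eq_top_of_tmul_mem (isClosed_leftCoeffSubmodule T h) h1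
    exact Submodule.eq_top_iff'.mp this k

/-- The left action of `A` on `F²(E) ⊗ H` as a bounded linear map. -/
noncomputable def fockLeftCLM : A →L[ℂ] C.FockHilbert V →L[ℂ] C.FockHilbert V :=
  LinearMap.mkContinuous
    { toFun := fun a => C.fockLeft V a
      map_add' := fun a b => ContinuousLinearMap.ext fun f => lp.ext (funext fun n =>
        congrArg (fun T => T (f.1 n)) (map_add (C.level V n).rep a b))
      map_smul' := fun c a => ContinuousLinearMap.ext fun f => lp.ext (funext fun n =>
        congrArg (fun T => T (f.1 n)) (map_smul (C.level V n).rep c a)) }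
    1 fun a => by
      rw [one_mul]
      exact C.norm_fockLeft_le V a

/-- The matrix coefficients of the left action of `A` on `F²(E) ⊗ H` are normal. -/
theorem matrixCoeff_fock_mem (k h : C.FockHilbert V) :
    matrixCoeff C.fockLeftCLM k h ∈ V.normalFunctionals := by
  -- A left vector concentrated in degree `n` sees only the component of `h` in that degree, since
  -- the action is diagonal. Thus only `k` has to be approximated by finite sums, and `h` stays
  -- arbitrary.
  have h1 : ∀ n (u : (C.level V n).space), matrixCoeff C.fockLeftCLM
      (lp.single 2 n u : lp (fun n => (C.level V n).space) 2) h ∈ V.normalFunctionals := by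
    intro n u
    have : matrixCoeff C.fockLeftCLM (lp.single 2 n u : lp (fun n => (C.level V n).space) 2) h =
        matrixCoeff (C.level V n).repCLM u (h.1 n) := by
      refine ContinuousLinearMap.ext fun c => ?_
      exact lp.inner_single_left (𝕜 := ℂ) (G := fun n => (C.level V n).space) n u _
    rw [this]
    exact C.matrixCoeff_level_mem n _ _
  have h2 : HasSum (fun n => (lp.single 2 n (k.1 n) : lp (fun n => (C.level V n).space) 2))
      (k : lp (fun n => (C.level V n).space) 2) :=
    lp.hasSum_single (E := fun n => (C.level V n).space) (by norm_num) k
  have h3 := isClosed_leftCoeffSubmodule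
    (S := Set.range fun p : H × H => V.functional p.1 p.2) C.fockLeftCLM h
  exact h3.mem_of_tendsto h2 (Filter.Eventually.of_forall fun s =>
    Submodule.sum_mem (leftCoeffSubmodule _ C.fockLeftCLM h) fun n _ => h1 n _)

end WStarCorrespondence

end Normality

open HilbertModule

/-! ### Vacuum, geometric series and generators on the Fock space. -/

section FockAlgebra

variable {A : Type v} [CStarAlgebra A] [PartialOrder A] [StarOrderedRing A]
  {H : Type u} [NormedAddCommGroup H] [InnerProductSpace ℂ H] [CompleteSpace H]
  {E : Type u} [NormedAddCommGroup E] [NormedSpace ℂ E] [Module Aᵐᵒᵖ E] [HilbertModule A E]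

namespace Correspondence

variable {C : Correspondence A E} {V : VonNeumannRep A H}

/-- `⟨x, y⟩` is represented on `H` by `y* x`. Together with `eq_of_functional_eq` this reduces
identities in the module to inner products in `F²(E) ⊗ H`, computed degree by degree. -/
theorem functional_ip (x y : C.Fock V) (h k : H) :
    V.functional h k (ip x y) = ⟪y.op k, x.op h⟫_ℂ := by
  change ⟪k, V.rep (fockIp x y) h⟫_ℂ = _
  rw [rep_fockIp, ContinuousLinearMap.comp_apply, ContinuousLinearMap.adjoint_inner_right]

theorem inner_fockHilbert (f g : C.FockHilbert V) :
    ⟪f, g⟫_ℂ = ∑' n, ⟪f.1 n, g.1 n⟫_ℂ :=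
  lp.inner_eq_tsum (𝕜 := ℂ) (G := fun n => (C.level V n).space) f g

variable (C V)

theorem summable_inner_fockHilbert (f g : C.FockHilbert V) :
    Summable fun n => ⟪f.1 n, g.1 n⟫_ℂ :=
  lp.summable_inner (𝕜 := ℂ) (G := fun n => (C.level V n).space) f g

theorem adjoint_fockLeft (a : A) : (C.fockLeft V a).adjoint = C.fockLeft V (star a) := by
  symm
  rw [ContinuousLinearMap.eq_adjoint_iff]
  intro f g
  rw [inner_fockHilbert, inner_fockHilbert]
  refine tsum_congr fun n => ?_
  change ⟪(C.level V n).rep (star a) (f.1 n), g.1 n⟫_ℂ = ⟪f.1 n, (C.level V n).rep a (g.1 n)⟫_ℂ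
  rw [map_star, ContinuousLinearMap.star_eq_adjoint, ContinuousLinearMap.adjoint_inner_left]

theorem op_phiInfty (a : A) (x : C.Fock V) :
    ((C.phiInfty V a).op x).op = C.fockLeft V a ∘L x.op := rfl

theorem ip_phiInfty (a : A) (x y : C.Fock V) :
    ip (A := A) ((C.phiInfty V a).op x) y = ip x ((C.phiInfty V (star a)).op y) := by
  refine V.eq_of_functional_eq fun h k => ?_
  rw [functional_ip, functional_ip, op_phiInfty, op_phiInfty, ← adjoint_fockLeft,
    ContinuousLinearMap.comp_apply, ContinuousLinearMap.comp_apply,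
    ContinuousLinearMap.adjoint_inner_left]

theorem phiInfty_mul (a b : A) (x : C.Fock V) :
    (C.phiInfty V (a * b)).op x = (C.phiInfty V a).op ((C.phiInfty V b).op x) :=
  Fock.ext <| ContinuousLinearMap.ext fun h => lp.ext <| funext fun n =>
    congrArg (fun T => T ((x.op h).1 n)) (map_mul (C.level V n).rep a b)

theorem phiInfty_add (a b : A) (x : C.Fock V) :
    (C.phiInfty V (a + b)).op x = (C.phiInfty V a).op x + (C.phiInfty V b).op x :=
  Fock.ext <| ContinuousLinearMap.ext fun h => lp.ext <| funext fun n =>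
    congrArg (fun T => T ((x.op h).1 n)) (map_add (C.level V n).rep a b)

theorem phiInfty_smul (c : ℂ) (a : A) (x : C.Fock V) :
    (C.phiInfty V (c • a)).op x = c • (C.phiInfty V a).op x :=
  Fock.ext <| ContinuousLinearMap.ext fun h => lp.ext <| funext fun n =>
    congrArg (fun T => T ((x.op h).1 n)) (map_smul (C.level V n).rep c a)

theorem phiInfty_zero (x : C.Fock V) : (C.phiInfty V 0).op x = 0 := by
  simpa using C.phiInfty_smul V 0 0 x

/-- `φ_∞(a) T_e = T_{a e}`. -/
theorem phiInfty_creationOp (a : A) (e : E) (x : C.Fock V) :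
    (C.phiInfty V a).op ((C.creationOp V e).op x) = (C.creationOp V (C.left a e)).op x :=
  Fock.ext <| ContinuousLinearMap.ext fun h => lp.ext <| funext fun n => by
    cases n with
    | zero => exact map_zero ((C.level V 0).rep a)
    | succ n => exact leftTensor_tmul C a e ((x.op h).1 n)

theorem inclusion_one : C.inclusion V 1 = C.vacuum V := by
  rw [inclusion, MulOpposite.op_one, one_smul]

/-- `T_e^* g = φ_∞(⟨z, e⟩) g` for the geometric series `g` of `z`. -/
theorem ip_creationOp_geometricSeries (z : Metric.ball (0 : E) 1) (e : E) (x : C.Fock V) :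
    ip (A := A) ((C.creationOp V e).op x) (C.geometricSeries V z) =
      ip ((C.phiInfty V (ip e z.1)).op x) (C.geometricSeries V z) := by
  refine V.eq_of_functional_eq fun h k => ?_
  rw [functional_ip, functional_ip, inner_fockHilbert, inner_fockHilbert,
    (C.summable_inner_fockHilbert V _ _).tsum_eq_zero_add]
  -- `T_e x` has no component in degree zero. The term of degree `n + 1` on the left matches the
  -- term of degree `n` on the right, because `z^{⊗(n+1)} = z ⊗ z^{⊗n}` and the pairing of `e` with
  -- the first factor `z` leaves the coefficient `⟨e, z⟩`.
  have h0 : ⟪((C.geometricSeries V z).op k).1 0,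
      (((C.creationOp V e).op x).op h).1 0⟫_ℂ = 0 := inner_zero_right _
  rw [h0, zero_add]
  exact tsum_congr fun n => inner_tmul z.1 e (C.tensorPower V z.1 n k) ((x.op h).1 n)

/-- The vacuum meets only the degree-zero entry of `g`, which is `1`. Hence `φ_∞(a*) g` determines
`a`. -/
theorem ip_vacuum_geometricSeries (z : Metric.ball (0 : E) 1) (a : A) :
    ip (A := A) ((C.phiInfty V a).op (C.vacuum V)) (C.geometricSeries V z) = a := by
  refine V.eq_of_functional_eq fun h k => ?_
  rw [ip_phiInfty, functional_ip]
  refine (lp.inner_single_right (𝕜 := ℂ) (G := fun n => (C.level V n).space) 0 (h : H) _).trans ?_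
  change ⟪V.rep (star a) k, h⟫_ℂ = ⟪k, V.rep a h⟫_ℂ
  rw [map_star, ContinuousLinearMap.star_eq_adjoint, ContinuousLinearMap.adjoint_inner_left]

theorem ip_poisson_one (z : Metric.ball (0 : E) 1) (a : A) (x : C.Fock V) :
    ip (A := A) x (C.poisson V z a 1) = ip ((C.phiInfty V a).op x) (C.geometricSeries V z) := by
  rw [ip_phiInfty, poisson, MulOpposite.op_one, one_smul]

/-- Moving `φ_∞(a*)` from `W 1` to the other side leaves the fixed vector `g` on the right; the
point `a` then enters as a left factor `φ_∞(a)`, where evaluations can be composed. -/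
theorem pointEval_eq (R : C.toeplitzAlgebra V) (z : Metric.ball (0 : E) 1) (a : A) :
    C.pointEval V R z a =
      ip ((C.phiInfty V a).op (R.1.op (C.vacuum V))) (C.geometricSeries V z) := by
  rw [← ip_poisson_one, ← inclusion_one]
  rfl

/-! ### The algebra on which evaluation composes. -/

/-- The adjointable operators `R` on the Fock space whose adjoint maps each `φ_∞(a*) g` to
`φ_∞(b*) g` for some `b`, where `g` is the geometric series of `z`. Testing on the vacuum vector gives
`b = ⟨φ_∞(a) R Ω, g⟩`. -/
noncomputable def evaluationAlgebra (z : Metric.ball (0 : E) 1) :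
    NonUnitalSubalgebra ℂ (Adjointable A (C.Fock V)) where
  carrier := {R | ∀ a x, ip (A := A) ((C.phiInfty V a).op (R.op x)) (C.geometricSeries V z) =
    ip ((C.phiInfty V (ip ((C.phiInfty V a).op (R.op (C.vacuum V)))
      (C.geometricSeries V z))).op x) (C.geometricSeries V z)}
  add_mem' {R S} hR hS a x := by
    simp only [Adjointable.op_add, map_add, ip_add_left, phiInfty_add]
    rw [hR, hS]
  zero_mem' a x := by
    have h (y : C.Fock V) : (0 : Adjointable A (C.Fock V)).op y = 0 := rfl
    simp only [h, map_zero, ip_zero_left, phiInfty_zero]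
  smul_mem' c R hR a x := by
    simp only [Adjointable.op_smul, map_smul, ip_smul_left, phiInfty_smul]
    rw [hR]
  mul_mem' {R S} hR hS a x := by
    simp only [Adjointable.op_mul]
    -- `R` transfers `a` to `b` at the vector `S x`, then `S` transfers `b`. The last rewriting
    -- applies the condition for `R` at `S Ω`, which identifies the result with the coefficient
    -- required for `R S`.
    rw [hR, hS, hR a (S.op (C.vacuum V))]

theorem mem_evaluationAlgebra {z : Metric.ball (0 : E) 1} {R : Adjointable A (C.Fock V)} :
    R ∈ C.evaluationAlgebra V z ↔ ∀ a x,
      ip (A := A) ((C.phiInfty V a).op (R.op x)) (C.geometricSeries V z) =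
        ip ((C.phiInfty V (ip ((C.phiInfty V a).op (R.op (C.vacuum V)))
          (C.geometricSeries V z))).op x) (C.geometricSeries V z) := Iff.rfl

/-- The transfer is `a ↦ a c`, because `φ_∞(a) φ_∞(c) = φ_∞(a c)`. -/
theorem phiInfty_mem_evaluationAlgebra (z : Metric.ball (0 : E) 1) (c : A) :
    C.phiInfty V c ∈ C.evaluationAlgebra V z := fun a x => by
  rw [← phiInfty_mul, ← phiInfty_mul, ip_vacuum_geometricSeries]

/-- The transfer is `a ↦ ⟨a e, z⟩`: absorb `φ_∞(a)` into the creation operator, then remove one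
factor from `g`. -/
theorem creationOp_mem_evaluationAlgebra (z : Metric.ball (0 : E) 1) (e : E) :
    C.creationOp V e ∈ C.evaluationAlgebra V z := fun a x => by
  rw [phiInfty_creationOp, phiInfty_creationOp, ip_creationOp_geometricSeries,
    ip_creationOp_geometricSeries, ip_vacuum_geometricSeries]

theorem phiInfty_mem_toeplitzAlgebra (a : A) : C.phiInfty V a ∈ C.toeplitzAlgebra V :=
  NonUnitalAlgebra.mem_sInf.mpr fun _ hS => hS.1 a

/-- The formula holds for non-unital left actions too: only degree zero matters, where `φ_∞(c)` is
multiplication by `c`. -/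
theorem pointEval_phiInfty (c : A) (z : Metric.ball (0 : E) 1) (a : A) :
    C.pointEval V ⟨C.phiInfty V c, C.phiInfty_mem_toeplitzAlgebra V c⟩ z a = a * c := by
  rw [pointEval_eq]
  change ip ((C.phiInfty V a).op ((C.phiInfty V c).op (C.vacuum V))) _ = _
  rw [← phiInfty_mul, ip_vacuum_geometricSeries]

end Correspondence

/-! ### Weak-`*` closedness and the composition law. -/

namespace WStarCorrespondence

variable {V : VonNeumannRep A H} (C : WStarCorrespondence V E)

open Correspondence

/-- Tested against vectors of `H`, the defining condition becomes a family of equalities between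
weak-`*` continuous functionals of `R`. The right-hand one is the map `R ↦ ⟨R Ω, W 1⟩` followed by a
matrix coefficient of `φ_∞`; this is where normality of the left action enters. -/
theorem isClosed_evaluationAlgebra (z : Metric.ball (0 : E) 1) :
    @IsClosed _ (V.moduleUltraweak (C.Fock V))
      (C.evaluationAlgebra V z : Set (Adjointable A (C.Fock V))) := by
  set g := C.geometricSeries V z
  have key : (C.evaluationAlgebra V z : Set (Adjointable A (C.Fock V))) =
      ⋂ (a : A) (x : C.Fock V) (h : H) (k : H),
        {R | (V.functional h k ∘L ipCLM x (C.poisson V z a 1)) R =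
          (matrixCoeff C.fockLeftCLM (g.op k) (x.op h) ∘L
            ipCLM (C.vacuum V) (C.poisson V z a 1)) R} := by
    ext R
    simp only [SetLike.mem_coe, mem_evaluationAlgebra, Set.mem_iInter, Set.mem_ofPred_eq]
    refine forall₂_congr fun a x => ?_
    rw [← C.ip_poisson_one V z a, ← C.ip_poisson_one V z a]
    constructor
    · intro hR h k
      refine (congrArg (V.functional h k) hR).trans ?_
      exact functional_ip (C := C.toCorrespondence) _ g h k
    · intro hR
      refine V.eq_of_functional_eq fun h k => (hR h k).trans ?_
      exact (functional_ip (C := C.toCorrespondence)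
        ((C.phiInfty V (ip (R.op (C.vacuum V)) (C.poisson V z a 1))).op x) g h k).symm
  rw [key]
  -- From here on the weak-`*` topology replaces the norm topology as the instance.
  let _ := V.moduleUltraweak (C.Fock V)
  refine isClosed_iInter fun a => isClosed_iInter fun x => isClosed_iInter fun h =>
    isClosed_iInter fun k => isClosed_weakStar_eq ?_ ?_
  · exact V.comp_ipCLM_mem_predual _ _ (mem_predual ⟨(h, k), rfl⟩)
  · exact V.comp_ipCLM_mem_predual _ _ (C.matrixCoeff_fock_mem _ _)

theorem toeplitzAlgebra_le_evaluationAlgebra (z : Metric.ball (0 : E) 1) :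
    C.toeplitzAlgebra V ≤ C.evaluationAlgebra V z :=
  sInf_le ⟨C.phiInfty_mem_evaluationAlgebra V z, C.creationOp_mem_evaluationAlgebra V z,
    C.isClosed_evaluationAlgebra z⟩

/-- This is the defining condition of `evaluationAlgebra` for `R`, read at the vector `S Ω`. -/
theorem pointEval_mul (R S : C.toeplitzAlgebra V) (z : Metric.ball (0 : E) 1) (a : A) :
    C.pointEval V (R * S) z a = C.pointEval V S z (C.pointEval V R z a) := by
  rw [pointEval_eq, pointEval_eq, pointEval_eq]
  exact C.toeplitzAlgebra_le_evaluationAlgebra z R.2 a (S.1.op (C.vacuum V))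

end WStarCorrespondence

end FockAlgebra

theorem propositionP {A : Type v} [CStarAlgebra A] [PartialOrder A] [StarOrderedRing A]
    {H : Type u} [NormedAddCommGroup H] [InnerProductSpace ℂ H] [CompleteSpace H]
    (V : VonNeumannRep A H)
    {E : Type u} [NormedAddCommGroup E] [NormedSpace ℂ E] [Module Aᵐᵒᵖ E] [HilbertModule A E]
    (C : WStarCorrespondence V E) :
    (∀ (R S : C.toeplitzAlgebra V) (z : Metric.ball (0 : E) 1) (a : A),
      C.pointEval V (R * S) z a = C.pointEval V S z (C.pointEval V R z a)) ∧
    (Nontrivial A → ∃ (R S : C.toeplitzAlgebra V) (z : Metric.ball (0 : E) 1) (a : A),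
      C.pointEval V (R * S) z a ≠ C.pointEval V R z a * C.pointEval V S z a) := by
  refine ⟨C.pointEval_mul, fun _ => ?_⟩
  -- The value of `φ_∞(1)` at `(ζ, a)` is `a` for every `ζ`, so the composition law gives `a` for
  -- the square while the product of values is `a * a`. With `a = 2` equality would mean `2 = 4` in
  -- a nontrivial algebra.
  refine ⟨⟨_, C.phiInfty_mem_toeplitzAlgebra V 1⟩, ⟨_, C.phiInfty_mem_toeplitzAlgebra V 1⟩,
    ⟨0, Metric.mem_ball_self one_pos⟩, (2 : ℂ) • 1, ?_⟩
  rw [C.pointEval_mul, Correspondence.pointEval_phiInfty, Correspondence.pointEval_phiInfty,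
    mul_one, mul_one, smul_mul_smul_comm, mul_one]
  intro h
  have := smul_left_injective ℂ (one_ne_zero (α := A)) h
  norm_num at this
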